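/- **Setting.** Let $\mathcal Y=[0,1]^d$, let $\mathcal A$ be a finite set of actions and $\mathcal N$ a finite family of agents. Each agent has a utility $u:\mathcal A\times\mathcal Y\to[0,1]$ and constraint functions $c_1,\dots,c_J:\mathcal A\times\mathcal Y\to[-1,1]$, measurable in $y$; every $u(a,\cdot)$ is linear (i.e. $u(a,k_1y_1+k_2y_2)=k_1u(a,y_1)+k_2u(a,y_2)$ whenever $y_1,y_2,k_1y_1+k_2y_2\in\mathcal Y$) and $L$-Lipschitz for $\|\cdot\|_\infty$. For $U\subseteq\mathcal A$ let $\mathrm{CBR}^u_U(p)$ be a maximizer of $u(\cdot,p)$ over $U$ (ties broken by a fixed measurable rule; arbitrary if $U=\emptyset$). Let $\delta\in(0,1)$. In each round $t=1,\dots,T$ an adaptive, possibly randomized adversary chooses a feature $x_t$ and a probability distribution $Y_t$ on $\mathcal Y$; a prediction $p_t\in\mathcal Y$ is made; each agent plays an action $a_t$; then $y_t\sim Y_t$ is drawn, independently of $p_t$ given everything that preceded the prediction. $\mathcal S=\{S_1,\dots,S_I\}$ is a family of subsequences of $[T]$ covering $[T]$; whether $t\in S_i$ is decided by a fixed measurable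 function of $(t,x_t)$, and the lengths $|S_i|$ are known in advance. For an agent put $$\mathcal A_S^{\mathbb E[\mathbf c]}=\{a:\ \mathbb E_{y\sim Y_t}[c_j(a,y)]\le 0\ \text{for all } t\in S,\ j\in[J]\},$$ and for $\mathcal B\subseteq\mathcal A$ $$\mathrm{Reg}_{\rm swap}(u,\mathcal B,S)=\max_{\phi:\mathcal A\to\mathcal B}\sum_{t\in S}\bigl(u(\phi(a_t),y_t)-u(a_t,y_t)\bigr),\qquad \mathrm{Reg}_{\rm ext}(u,\mathcal B,S)=\max_{a\in\mathcal B}\sum_{t\in S}\bigl(u(a,y_t)-u(a_t,y_t)\bigr).$$ **Agents' algorithm.** Each agent uses thresholds $\tau_S=4\sqrt{|S|\ln\frac{|\mathcal A||\mathcal N||\mathcal S|^2J|S|}{\delta}}$ (read as $\tau_S=0$ if $|S|=0$ or $J=0$). It starts with candidate sets $\hat{\mathcal A}_{1,S}=\mathcal A$ and $w^{a,j,S'}_S=0$ for all $a,j,S,S'$. In round $t$ it sets $U_t=\bigcup_{S\ni t}\hat{\mathcal A}_{t,S}$, plays $a_t=\mathrm{CBR}^u_{U_t}(p_t)$, lets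 $r_t$ be the least $i$ with $t\in S_i$ and $a_t\in\hat{\mathcal A}_{t,S_i}$, and adds $c_j(a_t,y_t)$ to $w^{a_t,j,S_{r_t}}_{S}$ for all $j$ and all $S\ni t$. If then $w^{a_t,j,S_{r_t}}_{S}>\tau_S$ for some $j\in[J]$, $S\in\mathcal S$, the action $a_t$ is removed from the candidate set of $S_{r_t}$; nothing else changes (and nothing at all changes if no such $r_t$ exists). **Predictions (Decision-Calibration-Subsequence).** The events are $E_{n,a,S}=\mathbb 1[t\in S]\cdot\mathbb 1[\mathrm{CBR}^u_{U_t}(p)=a]$, for agents $n\in\mathcal N$ (with their $u$ and $U_t$), $a\in\mathcal A$, $S\in\mathcal S$. For an event $E$, a coordinate $i\in[d]$ and a sign $\sigma\in\{\pm1\}$, and $\psi_s$ the distribution from which the prediction of round $s$ was drawn, let $g_s^{E,i,\sigma}=\sigma\,\mathbb E_{p\sim\psi_s}[E(p)(p^i-y_s^i)]$, $G=\sum_{s<t}g_s$ and $V=\sum_{s<t}g_s^2$. The weights are $$q_t^{E,i,\sigma}\ \propto\ \sum_{m=1}^{\lfloor\log_2T\rfloor+1}\eta_m\,e^{\eta_mG-\eta_m^2V},\qquad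 \eta_m=2^{-m}.$$ The prediction $p_t$ is drawn from a distribution $\psi_t$ on $\mathcal Y$, depending (measurably) only on the previous triples $(x_s,p_s,y_s)_{s<t}$ and $x_t$, that minimizes $$\sup_{y\in\mathcal Y}\ \sum_{E,i,\sigma}q_t^{E,i,\sigma}\,\sigma\,\mathbb E_{p\sim\psi}\bigl[E(p)(p^i-y^i)\bigr]$$ over all probability distributions $\psi$ on $\mathcal Y$ up to an additive error $1/T$. **Statement.** 1. Let the predictions be arbitrary (not necessarily those above) and let $\beta:\mathbb R\to\mathbb R$ be concave on $[0,\infty)$. With probability at least $1-\delta$ the following holds: if $\bigl\|\sum_{t\in S,\,a_t=a}(p_t-y_t)\bigr\|_\infty\le\beta\bigl(|\{t\in S:a_t=a\}|\bigr)$ for all agents, all $a\in\mathcal A$ and all $S\in\mathcal S$, then for every agent and every $S\in\mathcal S$ with $\mathcal A_S^{\mathbb E[\mathbf c]}\ne\emptyset$, $$\mathrm{Reg}_{\rm swap}(u,\mathcal A_S^{\mathbb E[\mathbf c]},S)\le 2L|\mathcal A|\,\beta(|S|/|\mathcal A|).$$ 2. Forecasters that implement Decision-Calibration-Subsequence exist,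 and there is an absolute constant $C>0$ such that, for every such forecaster and every adversary, with probability at least $1-\delta$, for every agent and every $S\in\mathcal S$ with $\mathcal A_S^{\mathbb E[\mathbf c]}\neq\emptyset$, both $\mathrm{Reg}_{\rm swap}(u,\mathcal A_S^{\mathbb E[\mathbf c]},S)$ and $\mathrm{Reg}_{\rm ext}(u,\mathcal A_S^{\mathbb E[\mathbf c]},S)$ are at most $$C\,L\,|\mathcal A|\sqrt{|S|\ln\frac{d\,|\mathcal A|\,|\mathcal N|\,|\mathcal S|\,T}{\delta}}.$$ (The root is read as $0$ in the degenerate case $d=0$.) -/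

import Mathlib

open MeasureTheory ProbabilityTheory

noncomputable section

namespace ConstrainedForecast

universe uX uA uN uO uK

/-- The prediction/outcome space `[0,1]^d`. The norm of `Fin d → ℝ` is the sup norm. -/
abbrev Cube (d : ℕ) : Type := Set.Icc (0 : Fin d → ℝ) 1

/-- The realized triples (feature, prediction, outcome) of the first `t` rounds. Rounds are
numbered `0, 1, …, T - 1`. -/
abbrev Transcript (𝒳 : Type uX) (d t : ℕ) : Type uX := Fin t → 𝒳 × Cube d × Cube d

/-- The first `s` rounds of a transcript. -/
def Transcript.take {𝒳 : Type uX} {d t : ℕ} (h : Transcript 𝒳 d t) (s : ℕ) (hs : s ≤ t) :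
    Transcript 𝒳 d s :=
  fun r => h (Fin.castLE hs r)

/-! ### Agents -/

/-- An agent: a utility function, `J` constraint functions, and the constrained best response
`cbr U p ∈ argmax_{a ∈ U} u(a, p)`, where ties are broken by an arbitrary measurable rule (and the
value of `cbr ∅ p` is arbitrary). -/
structure Agent (𝒜 : Type uA) (d J : ℕ) (L : ℝ) where
  u : 𝒜 → Cube d → ℝ
  c : Fin J → 𝒜 → Cube d → ℝ
  cbr : Finset 𝒜 → Cube d → 𝒜
  u_mem : ∀ a y, u a y ∈ Set.Icc (0 : ℝ) 1
  u_linear : ∀ (a : 𝒜) (k₁ k₂ : ℝ) (y₁ y₂ y : Cube d),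
    (y : Fin d → ℝ) = k₁ • (y₁ : Fin d → ℝ) + k₂ • (y₂ : Fin d → ℝ) →
      u a y = k₁ * u a y₁ + k₂ * u a y₂
  u_lipschitz : ∀ (a : 𝒜) (y₁ y₂ : Cube d),
    |u a y₁ - u a y₂| ≤ L * ‖(y₁ : Fin d → ℝ) - (y₂ : Fin d → ℝ)‖
  c_mem : ∀ j a y, c j a y ∈ Set.Icc (-1 : ℝ) 1
  c_measurable : ∀ j a, Measurable (c j a)
  cbr_mem : ∀ (U : Finset 𝒜) (p : Cube d), U.Nonempty → cbr U p ∈ U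
  cbr_max : ∀ (U : Finset 𝒜) (p : Cube d), ∀ b ∈ U, u b p ≤ u (cbr U p) p
  cbr_measurable : ∀ (U : Finset 𝒜) (a : 𝒜), MeasurableSet {p | cbr U p = a}

/-! ### The elimination algorithm for the expectation benchmarks -/

/-- Memory of the elimination algorithm: the candidate set of each subsequence, and the attributed
constraint violations `w a j S S'` (of action `a` against constraint `j`, over the rounds of `S`
for which `S'` is responsible). -/
structure ElimState (𝒜 : Type uA) (I J : ℕ) where
  cand : Fin I → Finset 𝒜
  w : 𝒜 → Fin J → Fin I → Fin I → ℝ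

/-- The union of the candidate sets of the active subsequences. -/
def ElimState.union {𝒜 : Type uA} {I J : ℕ} (st : ElimState 𝒜 I J) (act : Set (Fin I)) :
    Finset 𝒜 :=
  open Classical in (Finset.univ.filter (fun i => i ∈ act)).biUnion st.cand

/-- `i` is the smallest index of an active subsequence of which `a` is a candidate. -/
def ElimState.Responsible {𝒜 : Type uA} {I J : ℕ} (st : ElimState 𝒜 I J) (act : Set (Fin I))
    (a : 𝒜) (i : Fin I) : Prop :=
  IsLeast {i' : Fin I | i' ∈ act ∧ a ∈ st.cand i'} i

/-- Update of the attributed constraint violations after playing `a` and observing `y`. -/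
def ElimState.newW {𝒜 : Type uA} {d I J : ℕ} {L : ℝ} (ag : Agent 𝒜 d J L)
    (st : ElimState 𝒜 I J) (act : Set (Fin I)) (a : 𝒜) (y : Cube d) :
    𝒜 → Fin J → Fin I → Fin I → ℝ :=
  open Classical in fun b j S S' =>
    st.w b j S S' + if a = b ∧ S ∈ act ∧ st.Responsible act a S' then ag.c j b y else 0

/-- One round of the elimination algorithm with thresholds `τ`, active subsequences `act`,
prediction `p` and outcome `y`. -/
def ElimState.step {𝒜 : Type uA} {d I J : ℕ} {L : ℝ} (ag : Agent 𝒜 d J L) (τ : Fin I → ℝ)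
    (st : ElimState 𝒜 I J) (act : Set (Fin I)) (p y : Cube d) : ElimState 𝒜 I J :=
  open Classical in
  let a := ag.cbr (st.union act) p
  let w' := st.newW ag act a y
  { cand := fun S' =>
      if st.Responsible act a S' ∧ ∃ j S, τ S < w' a j S S' then (st.cand S').erase a
      else st.cand S'
    w := w' }

/-! ### The setup -/

/-- The data of the prediction problem: horizon `T`, failure probability `δ`, the agents, and the
subsequences `S_1, …, S_I`. Round `t` belongs to `S_i` iff the feature of that round lies in
`sub i t`; `len i` is the announced length of `S_i`. -/
structure Setup (𝒳 : Type uX) [MeasurableSpace 𝒳] (𝒜 : Type uA) (𝒩 : Type uN) (d J I : ℕ)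
    (L : ℝ) where
  T : ℕ
  δ : ℝ
  agent : 𝒩 → Agent 𝒜 d J L
  sub : Fin I → ℕ → Set 𝒳
  sub_measurable : ∀ i t, MeasurableSet (sub i t)
  len : Fin I → ℕ

section Elimination

variable {𝒳 : Type uX} [MeasurableSpace 𝒳] {𝒜 : Type uA} [Fintype 𝒜] {𝒩 : Type uN} [Fintype 𝒩]
  {d J I : ℕ} {L : ℝ} (P : Setup 𝒳 𝒜 𝒩 d J I L)

/-- The threshold `τ_S = 4 √(|S| ln(|𝒜| |𝒩| |𝒮|² J |S| / δ))`. -/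
def Setup.threshold (i : Fin I) : ℝ :=
  4 * √((P.len i : ℝ) * Real.log
    ((Fintype.card 𝒜 : ℝ) * Fintype.card 𝒩 * (I : ℝ) ^ 2 * J * P.len i / P.δ))

/-- The memory of agent `n` after a transcript of `t` rounds. -/
def Setup.elimState (n : 𝒩) : (t : ℕ) → Transcript 𝒳 d t → ElimState 𝒜 I J
  | 0, _ => { cand := fun _ => Finset.univ, w := fun _ _ _ _ => 0 }
  | t + 1, h =>
      (Setup.elimState n t (h.take t (Nat.le_succ t))).step (P.agent n) P.threshold
        {i | (h (Fin.last t)).1 ∈ P.sub i t} (h (Fin.last t)).2.1 (h (Fin.last t)).2.2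

/-- The candidate set `U_t` of agent `n`, given the previous rounds and the current feature. -/
def Setup.union (n : 𝒩) (t : ℕ) (h : Transcript 𝒳 d t) (x : 𝒳) : Finset 𝒜 :=
  (P.elimState n t h).union {i | x ∈ P.sub i t}

/-- The action `a_t = CBR_{U_t}(p)` of agent `n`. -/
def Setup.action (n : 𝒩) (t : ℕ) (h : Transcript 𝒳 d t) (x : 𝒳) (p : Cube d) : 𝒜 :=
  (P.agent n).cbr (P.union n t h x) p

end Elimination

/-! ### Unbiased prediction -/

/-- A (randomized) forecaster: the distribution of the prediction in round `t`, given the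
transcript of the previous rounds and the current feature. -/
abbrev Forecaster (𝒳 : Type uX) [MeasurableSpace 𝒳] (d : ℕ) : Type uX :=
  (t : ℕ) → Kernel (Transcript 𝒳 d t × 𝒳) (Cube d)

/-- A family of conditioning events: functions of transcript, feature and prediction. -/
abbrev EventFamily (κ : Type uK) (𝒳 : Type uX) (d : ℕ) : Type (max uK uX) :=
  κ → (t : ℕ) → Transcript 𝒳 d t → 𝒳 → Cube d → ℝ

/-- The indices `(E, i, σ)`: an event, a coordinate and a sign. -/
abbrev Expert (κ : Type uK) (d : ℕ) : Type uK := κ × Fin d × Bool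

/-- The signed conditional bias `σ · 𝔼_{p ∼ ν}[E(h, x, p) (p_i - y_i)]` of round `t`. -/
def gain {κ : Type uK} {𝒳 : Type uX} {d : ℕ} (E : EventFamily κ 𝒳 d) (ν : Measure (Cube d))
    (t : ℕ) (h : Transcript 𝒳 d t) (x : 𝒳) (y : Cube d) (k : Expert κ d) : ℝ :=
  (if k.2.2 then 1 else -1) *
    ∫ p, E k.1 t h x p * ((p : Fin d → ℝ) k.2.1 - (y : Fin d → ℝ) k.2.1) ∂ν

section Unbiased

variable {κ : Type uK} [Fintype κ] {𝒳 : Type uX} [MeasurableSpace 𝒳] {d : ℕ}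
  (E : EventFamily κ 𝒳 d) (ψ : Forecaster 𝒳 d)

/-- The signed bias that the forecaster `ψ` incurred in round `s` of the transcript. -/
def pastGain {t : ℕ} (h : Transcript 𝒳 d t) (k : Expert κ d) (s : Fin t) : ℝ :=
  gain E (ψ s (h.take s s.isLt.le, (h s).1)) s (h.take s s.isLt.le) (h s).1 (h s).2.2 k

/-- The weights `q_t`, proportional to a function `W` of the cumulative signed bias and of the
cumulative squared bias of each index. -/
def expertWeight (W : ℝ → ℝ → ℝ) {t : ℕ} (h : Transcript 𝒳 d t) (k : Expert κ d) : ℝ :=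
  W (∑ s, pastGain E ψ h k s) (∑ s, pastGain E ψ h k s ^ 2) /
    ∑ k', W (∑ s, pastGain E ψ h k' s) (∑ s, pastGain E ψ h k' s ^ 2)

/-- The objective of the minmax problem of round `t`, for the prediction distribution `ν` and the
outcome `y`. -/
def objective (W : ℝ → ℝ → ℝ) (t : ℕ) (h : Transcript 𝒳 d t) (x : 𝒳) (ν : Measure (Cube d))
    (y : Cube d) : ℝ :=
  ∑ k, expertWeight E ψ W h k * gain E ν t h x y k

/-- `ψ` runs the unbiased-prediction algorithm over `T` rounds: in every round it plays a
distribution that solves the minmax problem against the weights `q_t`, up to the additive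
tolerance `ε` (an exact minimizer need not exist, as the events are discontinuous in `p`). -/
def IsUnbiasedPrediction (W : ℝ → ℝ → ℝ) (ε : ℝ) (T : ℕ) : Prop :=
  (∀ t, IsMarkovKernel (ψ t)) ∧
  ∀ t < T, ∀ (h : Transcript 𝒳 d t) (x : 𝒳) (ν : Measure (Cube d)), IsProbabilityMeasure ν →
    (⨆ y, objective E ψ W t h x (ψ t (h, x)) y) ≤ (⨆ y, objective E ψ W t h x ν y) + ε

end Unbiased

/-- Second-order exponential weights with the learning rates `η = 2⁻¹, 2⁻², …, 2^{-(⌊log₂ T⌋+1)}`: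
the weight of an index with cumulative bias `G` and cumulative squared bias `V` is
`∑_η η exp(η G - η² V)`. -/
def multiscaleWeight (T : ℕ) (G V : ℝ) : ℝ :=
  ∑ m ∈ Finset.range (Nat.log 2 T + 1),
    (2⁻¹ : ℝ) ^ (m + 1) * Real.exp ((2⁻¹ : ℝ) ^ (m + 1) * G - ((2⁻¹ : ℝ) ^ (m + 1)) ^ 2 * V)

section Interaction

variable {𝒳 : Type uX} [MeasurableSpace 𝒳] {𝒜 : Type uA} [Fintype 𝒜] {𝒩 : Type uN} [Fintype 𝒩]
  {d J I : ℕ} {L : ℝ} (P : Setup 𝒳 𝒜 𝒩 d J I L)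

/-- The events `1[t ∈ S] · 1[CBR_{U_t}(p) = a]`, indexed by agents, actions and subsequences. -/
def Setup.events : EventFamily (𝒩 × 𝒜 × Fin I) 𝒳 d :=
  open Classical in fun e t h x p =>
    if x ∈ P.sub e.2.2 t ∧ P.action e.1 t h x p = e.2.1 then 1 else 0

/-- `ψ` is an implementation of Decision-Calibration-Subsequence. -/
def Setup.IsDecisionCalibrationSubsequence (ψ : Forecaster 𝒳 d) : Prop :=
  IsUnbiasedPrediction P.events ψ (multiscaleWeight P.T) (1 / (P.T : ℝ)) P.T

/-! ### The interaction -/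

/-- The transcript of the rounds before `t` along a path. -/
def pathTranscript {d : ℕ} (x : ℕ → 𝒳) (p y : ℕ → Cube d) (t : ℕ) : Transcript 𝒳 d t :=
  fun s => (x s, p s, y s)

/-- The actions played by agent `n` along a path. -/
def Setup.pathAction (x : ℕ → 𝒳) (p y : ℕ → Cube d) (n : 𝒩) (t : ℕ) : 𝒜 :=
  P.action n t (pathTranscript x p y t) (x t) (p t)

/-- The subsequence `S_i ⊆ {0, …, T - 1}` along a path. -/
def Setup.subseq (x : ℕ → 𝒳) (i : Fin I) : Finset ℕ :=
  open Classical in (Finset.range P.T).filter (fun t => x t ∈ P.sub i t)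

/-- The repeated interaction between adversary, predictions and agents, on a probability space.
`𝓕 t` is the information present once the adversary has moved in round `t`: all previous
features, predictions and outcomes, the feature `x t` and the outcome distribution `D t`, and
possibly private information of the adversary. The outcome `y t` is drawn from `D t`
independently of the prediction `p t`. The subsequences cover all rounds and have the announced
lengths. -/
structure Setup.IsInteraction {Ω : Type uO} [mΩ : MeasurableSpace Ω] (μ : Measure Ω)
    (𝓕 : Filtration ℕ mΩ) (x : ℕ → Ω → 𝒳) (D : ℕ → Ω → Measure (Cube d))
    (p y : ℕ → Ω → Cube d) : Prop where
  x_measurable : ∀ t < P.T, Measurable[𝓕 t] (x t)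
  D_measurable : ∀ t < P.T, Measurable[𝓕 t] (D t)
  D_prob : ∀ t < P.T, ∀ ω, IsProbabilityMeasure (D t ω)
  p_measurable : ∀ t < P.T, Measurable[𝓕 (t + 1)] (p t)
  y_measurable : ∀ t < P.T, Measurable[𝓕 (t + 1)] (y t)
  y_law : ∀ t < P.T, ∀ B : Set (Cube d), MeasurableSet B →
    μ⟦y t ⁻¹' B | (𝓕 t) ⊔ MeasurableSpace.comap (p t) inferInstance⟧
      =ᵐ[μ] fun ω => (D t ω).real B
  covers : ∀ᵐ ω ∂μ, ∀ t < P.T, ∃ i, t ∈ P.subseq (fun s => x s ω) i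
  length : ∀ᵐ ω ∂μ, ∀ i, (P.subseq (fun s => x s ω) i).card = P.len i

/-- In every round, the prediction is drawn from the distribution chosen by the forecaster `ψ`
from the transcript and the current feature. -/
def FollowsForecaster {Ω : Type uO} [mΩ : MeasurableSpace Ω] (μ : Measure Ω)
    (𝓕 : Filtration ℕ mΩ) (T : ℕ) (x : ℕ → Ω → 𝒳) (p y : ℕ → Ω → Cube d)
    (ψ : Forecaster 𝒳 d) : Prop :=
  ∀ t < T, ∀ B : Set (Cube d), MeasurableSet B →
    μ⟦p t ⁻¹' B | 𝓕 t⟧ =ᵐ[μ] fun ω =>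
      (ψ t (pathTranscript (fun s => x s ω) (fun s => p s ω) (fun s => y s ω) t, x t ω)).real B

/-! ### Benchmarks, regret and decision calibration -/

/-- The benchmark class of the actions that satisfy all constraints in expectation in every round
of `S`. -/
def expBenchmark (ag : Agent 𝒜 d J L) (D : ℕ → Measure (Cube d)) (S : Finset ℕ) : Set 𝒜 :=
  {a | ∀ t ∈ S, ∀ j, ∫ y, ag.c j a y ∂(D t) ≤ 0}

/-- The `B`-constrained swap regret over `S`; a maximum over finitely many `φ : 𝒜 → B`. -/
def swapRegret (u : 𝒜 → Cube d → ℝ) (B : Set 𝒜) (S : Finset ℕ) (a : ℕ → 𝒜)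
    (y : ℕ → Cube d) : ℝ :=
  ⨆ φ : 𝒜 → B, ∑ t ∈ S, (u (φ (a t)) (y t) - u (a t) (y t))

/-- The `B`-constrained external regret over `S`. -/
def extRegret (u : 𝒜 → Cube d → ℝ) (B : Set 𝒜) (S : Finset ℕ) (a : ℕ → 𝒜)
    (y : ℕ → Cube d) : ℝ :=
  ⨆ b : B, ∑ t ∈ S, (u b (y t) - u (a t) (y t))

/-- `(𝒩, 𝒮, β)`-decision calibration along a path. -/
def Setup.IsDecisionCalibrated (β : ℝ → ℝ) (x : ℕ → 𝒳) (p y : ℕ → Cube d) : Prop :=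
  open Classical in
  ∀ (i : Fin I) (a : 𝒜) (n : 𝒩),
    ‖∑ t ∈ (P.subseq x i).filter (fun t => P.pathAction x p y n t = a),
        ((p t : Fin d → ℝ) - (y t : Fin d → ℝ))‖
      ≤ β (((P.subseq x i).filter (fun t => P.pathAction x p y n t = a)).card : ℝ)

end Interaction

end ConstrainedForecast

end

open ConstrainedForecast

/-! The proof separates elimination from prediction.

Elimination. A violation is charged to `S'` only in rounds of `S'`. If `a` satisfies the constraints
in expectation throughout `S'`, every charged term has conditional mean at most `0`, and at most
`|S|` terms enter the sum over `S`. Hoeffding's inequality and a union bound show that, outside an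
event of probability `δ / |𝒜|`, no such action ever leaves the candidate set of `S'`
(`measure_exists_threshold_lt_le`, `mem_cand_of_expBenchmark`). Hence it belongs to every `U_t` with
`t ∈ S'`, and the best response does at least as well as it on the prediction. Since utilities are
linear and Lipschitz, passing from predictions to outcomes on the rounds where `a` is played costs
at most `2L` times the norm of the summed bias there (`Agent.sum_u_sub_le`). Summing over the played
actions, with Jensen's inequality for `β`, gives the first claim (`swapRegret_le_of_bias_le`).

Prediction. The minmax value of each round is at most `0`: a predictor who knew the outcome would
predict it, and Sion's theorem on a finite net exchanges the players
(`exists_distribution_bias_le`). The weighted bias is therefore at most `1 / T` per round. An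
exponential potential over all experts and learning rates then at most doubles over `T` rounds
(`mul_sum_sub_sq_mul_sum_sq_le`), and the rate of order `√(Λ / |S|)`, with `Λ` the logarithm in the
bound, yields expected bias `O(√(|S| Λ))` (`le_sqrt_of_forall_learning_rate`). Realized bias differs
from expected bias by a sum that is centered given the past and the outcome, because the prediction
is independent of the outcome; Hoeffding applies again (`measure_samplingError_gt_le`). Subsequences
shorter than `Λ` are covered by the trivial bound `L |S|`.

Existence of a forecaster is a question of measurable selection. Given the candidate sets and the
active subsequences, the events depend on the prediction alone, and the objective is Lipschitz in
the weights. Rounding the weights leaves countably many minmax problems, and choices indexed by a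
countable code are measurable (`exists_kernel_worstBias_le`). -/

noncomputable section

namespace ConstrainedForecast

universe uX uA uN uO uK

open scoped ENNReal

/-! ### Disintegration and sub-Gaussian tails for adapted sums. -/

section Probability

/-- Disintegration of the joint law of `(X, y)` when the law of `y` on rectangles is given by a
kernel in `X`. -/
lemma lintegral_comp_prod_of_rectangles {Ω α E : Type*} [MeasurableSpace Ω] [MeasurableSpace α]
    [MeasurableSpace E] {μ : Measure Ω} [IsProbabilityMeasure μ] (κ : Kernel α E)
    [IsMarkovKernel κ] {X : Ω → α} (hX : Measurable X) {y : Ω → E} (hy : Measurable y)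
    (law : ∀ A B, MeasurableSet A → MeasurableSet B →
      μ (X ⁻¹' A ∩ y ⁻¹' B) = ∫⁻ ω in X ⁻¹' A, κ (X ω) B ∂μ)
    {H : α × E → ℝ≥0∞} (hH : Measurable H) :
    ∫⁻ ω, H (X ω, y ω) ∂μ = ∫⁻ ω, ∫⁻ e, H (X ω, e) ∂κ (X ω) ∂μ := by
  have : IsProbabilityMeasure (μ.map X) := Measure.isProbabilityMeasure_map hX.aemeasurable
  have : IsProbabilityMeasure (μ.map fun ω => (X ω, y ω)) :=
    Measure.isProbabilityMeasure_map (hX.prodMk hy).aemeasurable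
  have key : μ.map (fun ω => (X ω, y ω)) = (μ.map X) ⊗ₘ κ := by
    refine Measure.ext_prod fun {A B} hA hB => ?_
    rw [Measure.map_apply (hX.prodMk hy) (hA.prod hB), Measure.compProd_apply_prod hA hB,
      setLIntegral_map hA (κ.measurable_coe hB) hX, ← law A B hA hB]
    rfl
  rw [← lintegral_map hH (hX.prodMk hy), key, Measure.lintegral_compProd hH,
    lintegral_map hH.lintegral_kernel_prod_right' hX]

/-- If the conditional law of `y` given `m` is the `m`-measurable random measure `κ`, then
integrals of `m`-measurable functions of `y` may be computed by integrating `κ` out first. -/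
lemma lintegral_of_condExp_law {Ω E : Type*} {m mΩ : MeasurableSpace Ω} [mE : MeasurableSpace E]
    (hm : m ≤ mΩ) {μ : Measure Ω} [IsProbabilityMeasure μ] {κ : Ω → Measure E}
    (hκ : Measurable[m] κ) (hp : ∀ ω, IsProbabilityMeasure (κ ω)) {y : Ω → E} (hy : Measurable y)
    (law : ∀ B, MeasurableSet B → μ⟦y ⁻¹' B | m⟧ =ᵐ[μ] fun ω => (κ ω).real B)
    {H : Ω × E → ℝ≥0∞} (hH : Measurable[m.prod mE] H) :
    ∫⁻ ω, H (ω, y ω) ∂μ = ∫⁻ ω, ∫⁻ e, H (ω, e) ∂κ ω ∂μ := by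
  -- As `κ` is `m`-measurable, it is a kernel out of `(Ω, m)`, and the previous lemma applies with
  -- `X` the identity from `(Ω, mΩ)` to `(Ω, m)`.
  let K : @Kernel Ω E m mE := @Kernel.mk Ω E m mE κ hκ
  have : @IsMarkovKernel Ω E m mE K := @IsMarkovKernel.mk Ω E m mE K hp
  refine @lintegral_comp_prod_of_rectangles Ω Ω E mΩ m mE μ _ K _ id
    (measurable_id'' hm) y hy (fun A B hA hB => ?_) H hH
  have hAm : MeasurableSet A := hm A hA
  have hreal : ∀ ω, K ω B = ENNReal.ofReal ((κ ω).real B) := fun ω => by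
    have := hp ω
    exact (ENNReal.ofReal_toReal (measure_ne_top (κ ω) B)).symm
  have hint : Integrable (fun ω => (κ ω).real B) μ :=
    integrable_condExp.congr (law B hB)
  calc μ (A ∩ y ⁻¹' B) = ENNReal.ofReal (μ.real (A ∩ y ⁻¹' B)) := by
        rw [measureReal_def, ENNReal.ofReal_toReal (measure_ne_top _ _)]
    _ = ENNReal.ofReal (∫ ω in A, (y ⁻¹' B).indicator (fun _ => (1 : ℝ)) ω ∂μ) := by
        rw [integral_indicator (hy hB), setIntegral_const, smul_eq_mul, mul_one,
          measureReal_restrict_apply (hy hB), Set.inter_comm]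
    _ = ENNReal.ofReal (∫ ω in A, (κ ω).real B ∂μ) := by
        rw [← setIntegral_condExp hm ((integrable_const (1 : ℝ)).indicator (hy hB)) hA]
        congr 1
        exact setIntegral_congr_ae hAm ((law B hB).mono fun ω h _ => h)
    _ = ∫⁻ ω in A, K ω B ∂μ := by
        rw [ofReal_integral_eq_lintegral_ofReal hint.integrableOn
          (Filter.Eventually.of_forall fun ω => measureReal_nonneg)]
        simp_rw [hreal]

/-- Exponential process whose multiplicative increments have conditional expectation at most
one. -/
lemma lintegral_exp_sum_le_one {Ω : Type*} {mΩ : MeasurableSpace Ω} {μ : Measure Ω}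
    [IsProbabilityMeasure μ] (𝓕 : Filtration ℕ mΩ) (T : ℕ) (ξ : ℕ → Ω → ℝ)
    (hξ : ∀ t < T, Measurable[𝓕 (t + 1)] (ξ t))
    (hstep : ∀ t < T, ∀ f : Ω → ℝ≥0∞, Measurable[𝓕 t] f →
      ∫⁻ ω, f ω * ENNReal.ofReal (Real.exp (ξ t ω)) ∂μ ≤ ∫⁻ ω, f ω ∂μ) :
    ∫⁻ ω, ENNReal.ofReal (Real.exp (∑ t ∈ Finset.range T, ξ t ω)) ∂μ ≤ 1 := by
  suffices h : ∀ n ≤ T, ∫⁻ ω, ENNReal.ofReal (Real.exp (∑ t ∈ Finset.range n, ξ t ω)) ∂μ ≤ 1 from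
    h T le_rfl
  intro n
  induction n with
  | zero => intro _; simp
  | succ n ih =>
    intro hn
    refine le_trans ?_ (ih (by omega))
    simp_rw [Finset.sum_range_succ, Real.exp_add, ENNReal.ofReal_mul (Real.exp_nonneg _)]
    refine hstep n (by omega) _ ?_
    refine ENNReal.measurable_ofReal.comp (Real.measurable_exp.comp ?_)
    refine Finset.measurable_sum _ fun t ht => ?_
    have := Finset.mem_range.1 ht
    exact (hξ t (by omega)).mono (𝓕.mono (by omega)) le_rfl

/-- Sub-Gaussian tail bound for a sum whose variance proxy is almost surely at most `n`. -/
lemma measure_sum_gt_le {Ω : Type*} {mΩ : MeasurableSpace Ω} {μ : Measure Ω} (T : ℕ)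
    (X b : ℕ → Ω → ℝ) {n τ : ℝ} (hn : 0 < n) (hτ : 0 ≤ τ)
    (hexp : ∀ l : ℝ, 0 ≤ l → ∫⁻ ω, ENNReal.ofReal (Real.exp
      (∑ t ∈ Finset.range T, (l * X t ω - l ^ 2 / 2 * b t ω))) ∂μ ≤ 1)
    (hb : ∀ᵐ ω ∂μ, ∑ t ∈ Finset.range T, b t ω ≤ n)
    (hX : ∀ t < T, Measurable (X t)) (hbm : ∀ t < T, Measurable (b t)) :
    μ {ω | τ < ∑ t ∈ Finset.range T, X t ω} ≤ ENNReal.ofReal (Real.exp (-(τ ^ 2 / (2 * n)))) := by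
  -- The minimizer of the Chernoff exponent `-l τ + l² n / 2`.
  set l := τ / n with hl
  have hl0 : 0 ≤ l := by positivity
  set Z : Ω → ℝ≥0∞ := fun ω => ENNReal.ofReal (Real.exp
      (∑ t ∈ Finset.range T, (l * X t ω - l ^ 2 / 2 * b t ω)))
  have hZ : Measurable Z := by
    refine ENNReal.measurable_ofReal.comp (Real.measurable_exp.comp ?_)
    refine Finset.measurable_sum _ fun t ht => ?_
    have := Finset.mem_range.1 ht
    exact ((hX t this).const_mul _).sub ((hbm t this).const_mul _)
  set e := ENNReal.ofReal (Real.exp (τ ^ 2 / (2 * n))) with he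
  have he0 : e ≠ 0 := by simp [he, Real.exp_pos]
  calc μ {ω | τ < ∑ t ∈ Finset.range T, X t ω} ≤ μ {ω | e ≤ Z ω} := by
        refine measure_mono_ae ?_
        filter_upwards [hb] with ω hω h
        change τ < _ at h
        refine ENNReal.ofReal_le_ofReal (Real.exp_le_exp.2 ?_)
        rw [Finset.sum_sub_distrib, ← Finset.mul_sum, ← Finset.mul_sum]
        have h1 : l * τ ≤ l * ∑ t ∈ Finset.range T, X t ω := by gcongr
        have h2 : l ^ 2 / 2 * ∑ t ∈ Finset.range T, b t ω ≤ l ^ 2 / 2 * n := by gcongr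
        have h3 : l * τ - l ^ 2 / 2 * n = τ ^ 2 / (2 * n) := by rw [hl]; field_simp; ring
        linarith
    _ ≤ (∫⁻ ω, Z ω ∂μ) / e := meas_ge_le_lintegral_div hZ.aemeasurable he0 (by simp [he])
    _ ≤ 1 / e := by gcongr; exact hexp l hl0
    _ = ENNReal.ofReal (Real.exp (-(τ ^ 2 / (2 * n)))) := by
        rw [Real.exp_neg, ENNReal.ofReal_inv_of_pos (Real.exp_pos _), one_div]

/-- Hoeffding's lemma for a random variable with values in an interval of length two. -/
lemma lintegral_exp_centered_le {E : Type*} [MeasurableSpace E] (ν : Measure E)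
    [IsProbabilityMeasure ν] {f : E → ℝ} (hf : Measurable f) {a : ℝ}
    (hb : ∀ e, f e ∈ Set.Icc a (a + 2)) (l : ℝ) :
    ∫⁻ e, ENNReal.ofReal (Real.exp (l * (f e - ∫ e', f e' ∂ν) - l ^ 2 / 2)) ∂ν ≤ 1 := by
  have h := hasSubgaussianMGF_of_mem_Icc (μ := ν) hf.aemeasurable
    (Filter.Eventually.of_forall hb)
  have h1 := h.integrable_exp_mul l
  have h2 := h.mgf_le l
  rw [mgf] at h2
  -- Length two is chosen so that Hoeffding's variance proxy, the squared half-length, equals one.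
  have h3 : ((((‖a + 2 - a‖₊ / 2) ^ 2 : NNReal)) : ℝ) = 1 := by
    simp
  rw [h3] at h2
  have h4 : ∀ e, Real.exp (l * (f e - ∫ e', f e' ∂ν) - l ^ 2 / 2)
      = Real.exp (l * (f e - ∫ e', f e' ∂ν)) * Real.exp (-(l ^ 2 / 2)) := fun e => by
    rw [← Real.exp_add]; ring_nf
  simp_rw [h4]
  rw [← ofReal_integral_eq_lintegral_ofReal (h1.mul_const _)
    (Filter.Eventually.of_forall fun e => by positivity), integral_mul_const]
  rw [← ENNReal.ofReal_one]
  refine ENNReal.ofReal_le_ofReal ?_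
  calc _ ≤ Real.exp (1 * l ^ 2 / 2) * Real.exp (-(l ^ 2 / 2)) := by gcongr
    _ = 1 := by rw [← Real.exp_add]; ring_nf; simp

end Probability

/-! ### Measurability of the agents' memory, actions and events. -/

section Measurability

/-- A random memory of the elimination algorithm is measurable if its candidate sets and its
attributed violations are. -/
structure ElimState.IsMeasurable {α : Type*} [MeasurableSpace α] {𝒜 : Type uA} {I J : ℕ}
    (st : α → ElimState 𝒜 I J) : Prop where
  cand : ∀ i a, MeasurableSet {ω | a ∈ (st ω).cand i}
  w : ∀ a j S S', Measurable fun ω => (st ω).w a j S S'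

variable {𝒜 : Type uA} {d I J : ℕ} {L : ℝ}

lemma ElimState.mem_union {st : ElimState 𝒜 I J} {act : Set (Fin I)} {a : 𝒜} :
    a ∈ st.union act ↔ ∃ i, i ∈ act ∧ a ∈ st.cand i := by
  classical simp [ElimState.union]

/-- Responsibility is now asked of the fixed action `b` instead of the played one, which makes the
condition an intersection of events that are visibly measurable. -/
lemma ElimState.newW_eq {ag : Agent 𝒜 d J L} {st : ElimState 𝒜 I J} {act : Set (Fin I)}
    {a : 𝒜} {y : Cube d} {b : 𝒜} {j : Fin J} {S S' : Fin I} :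
    st.newW ag act a y b j S S' = st.w b j S S' +
      (open Classical in if a = b ∧ S ∈ act ∧ st.Responsible act b S' then ag.c j b y else 0) := by
  classical
  simp only [ElimState.newW]
  congr 1
  refine if_congr ?_ rfl rfl
  constructor
  · rintro ⟨rfl, h⟩; exact ⟨rfl, h⟩
  · rintro ⟨rfl, h⟩; exact ⟨rfl, h⟩

variable {α : Type*} [MeasurableSpace α] [Fintype 𝒜] {st : α → ElimState 𝒜 I J}
  {act : α → Set (Fin I)} {p y : α → Cube d}

lemma ElimState.IsMeasurable.measurableSet_mem_union (hst : ElimState.IsMeasurable st)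
    (hact : ∀ i, MeasurableSet {ω | i ∈ act ω}) (a : 𝒜) :
    MeasurableSet {ω | a ∈ (st ω).union (act ω)} := by
  simp_rw [ElimState.mem_union, Set.ofPred_exists]
  exact MeasurableSet.iUnion fun i => (hact i).inter (hst.cand i a)

lemma ElimState.IsMeasurable.measurableSet_union_eq (hst : ElimState.IsMeasurable st)
    (hact : ∀ i, MeasurableSet {ω | i ∈ act ω}) (U : Finset 𝒜) :
    MeasurableSet {ω | (st ω).union (act ω) = U} := by
  simp_rw [Finset.ext_iff, Set.ofPred_forall]
  refine MeasurableSet.iInter fun a => ?_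
  by_cases ha : a ∈ U
  · simpa [ha] using hst.measurableSet_mem_union hact a
  · have : {ω | a ∈ (st ω).union (act ω) ↔ a ∈ U} = {ω | a ∈ (st ω).union (act ω)}ᶜ := by
      ext ω; simp [ha]
    rw [this]
    exact (hst.measurableSet_mem_union hact a).compl

/-- Best responses are measurable for a fixed candidate set only, so the event is split over the
finitely many values of that set. -/
lemma ElimState.IsMeasurable.measurableSet_cbr_eq (hst : ElimState.IsMeasurable st)
    (hact : ∀ i, MeasurableSet {ω | i ∈ act ω}) (ag : Agent 𝒜 d J L) (hp : Measurable p) (a : 𝒜) :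
    MeasurableSet {ω | ag.cbr ((st ω).union (act ω)) (p ω) = a} := by
  have : {ω | ag.cbr ((st ω).union (act ω)) (p ω) = a} =
      ⋃ U : Finset 𝒜, {ω | (st ω).union (act ω) = U} ∩ p ⁻¹' {q | ag.cbr U q = a} := by
    ext ω; simp
  rw [this]
  exact MeasurableSet.iUnion fun U =>
    (hst.measurableSet_union_eq hact U).inter (hp (ag.cbr_measurable U a))

lemma ElimState.IsMeasurable.measurableSet_responsible (hst : ElimState.IsMeasurable st)
    (hact : ∀ i, MeasurableSet {ω | i ∈ act ω}) (a : 𝒜) (i : Fin I) :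
    MeasurableSet {ω | (st ω).Responsible (act ω) a i} := by
  have h : ∀ i, MeasurableSet {ω | i ∈ act ω ∧ a ∈ (st ω).cand i} := fun i =>
    (hact i).inter (hst.cand i a)
  have : {ω | (st ω).Responsible (act ω) a i} = {ω | i ∈ act ω ∧ a ∈ (st ω).cand i} ∩
      ⋂ i' : Fin I, {ω | (i' ∈ act ω ∧ a ∈ (st ω).cand i') → i ≤ i'} := by
    ext ω; simp [ElimState.Responsible, IsLeast, mem_lowerBounds]
  rw [this]
  refine (h i).inter (MeasurableSet.iInter fun i' => ?_)
  by_cases hi : i ≤ i'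
  · simp [hi]
  · have : {ω | (i' ∈ act ω ∧ a ∈ (st ω).cand i') → i ≤ i'} =
        {ω | i' ∈ act ω ∧ a ∈ (st ω).cand i'}ᶜ := by
      ext ω; simp [hi]
    rw [this]
    exact (h i').compl

/-- The rounds that count for the violation attributed to `S'` on `S`. -/
lemma ElimState.IsMeasurable.measurableSet_attributed (hst : ElimState.IsMeasurable st)
    (hact : ∀ i, MeasurableSet {ω | i ∈ act ω}) (ag : Agent 𝒜 d J L) (hp : Measurable p) (b : 𝒜)
    (S S' : Fin I) :
    MeasurableSet {ω | ag.cbr ((st ω).union (act ω)) (p ω) = b ∧ S ∈ act ω ∧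
      (st ω).Responsible (act ω) b S'} :=
  (hst.measurableSet_cbr_eq hact ag hp b).inter
    ((hact S).inter (hst.measurableSet_responsible hact b S'))

lemma ElimState.IsMeasurable.step (hst : ElimState.IsMeasurable st)
    (hact : ∀ i, MeasurableSet {ω | i ∈ act ω}) (ag : Agent 𝒜 d J L) (τ : Fin I → ℝ)
    (hp : Measurable p) (hy : Measurable y) :
    ElimState.IsMeasurable fun ω => (st ω).step ag τ (act ω) (p ω) (y ω) := by
  classical
  have hw : ∀ b j S S', Measurable fun ω =>
      (st ω).newW ag (act ω) (ag.cbr ((st ω).union (act ω)) (p ω)) (y ω) b j S S' := by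
    intro b j S S'
    simp_rw [ElimState.newW_eq]
    exact (hst.w b j S S').add (Measurable.ite (hst.measurableSet_attributed hact ag hp b S S')
      ((ag.c_measurable j b).comp hy) measurable_const)
  refine ⟨fun i a => ?_, hw⟩
  have : {ω | a ∈ ((st ω).step ag τ (act ω) (p ω) (y ω)).cand i} =
      {ω | a ∈ (st ω).cand i} \ ({ω | ag.cbr ((st ω).union (act ω)) (p ω) = a} ∩
        ({ω | (st ω).Responsible (act ω) a i} ∩
        ⋃ j : Fin J, ⋃ S : Fin I, {ω | τ S < (st ω).newW ag (act ω)
          (ag.cbr ((st ω).union (act ω)) (p ω)) (y ω) a j S i})) := by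
    ext ω
    simp only [ElimState.step, Set.mem_ofPred_eq, Set.mem_sdiff, Set.mem_inter_iff, Set.mem_iUnion]
    split_ifs with h
    · rw [Finset.mem_erase]
      constructor
      · rintro ⟨h1, h2⟩; exact ⟨h2, fun h3 => h1 h3.1.symm⟩
      · rintro ⟨h1, h2⟩
        refine ⟨fun h3 => h2 ⟨h3.symm, ?_⟩, h1⟩
        rw [← h3] at h
        exact h3 ▸ h
    · constructor
      · intro h1; refine ⟨h1, fun h2 => h ?_⟩
        rw [h2.1]
        rw [h2.1] at h2
        exact h2.2
      · exact fun h1 => h1.1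
  rw [this]
  exact (hst.cand i a).diff ((hst.measurableSet_cbr_eq hact ag hp a).inter
    ((hst.measurableSet_responsible hact a i).inter (MeasurableSet.iUnion fun j =>
      MeasurableSet.iUnion fun S => measurableSet_lt measurable_const (hw a j S i))))

variable {𝒳 : Type uX} [MeasurableSpace 𝒳] {𝒩 : Type uN} [Fintype 𝒩]
  (P : Setup 𝒳 𝒜 𝒩 d J I L)

lemma Setup.isMeasurable_elimState (n : 𝒩) (t : ℕ) : ElimState.IsMeasurable (P.elimState n t) := by
  induction t with
  | zero => exact ⟨fun i a => by simp [Setup.elimState], fun a j S S' => by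
      simp [Setup.elimState]⟩
  | succ t ih =>
    have hlast : Measurable fun h : Transcript 𝒳 d (t + 1) => h (Fin.last t) :=
      measurable_pi_apply _
    have htake : Measurable fun h : Transcript 𝒳 d (t + 1) => h.take t (Nat.le_succ t) :=
      measurable_pi_lambda _ fun r => measurable_pi_apply _
    have ih' : ElimState.IsMeasurable fun h : Transcript 𝒳 d (t + 1) =>
        P.elimState n t (h.take t (Nat.le_succ t)) :=
      ⟨fun i a => htake (ih.cand i a), fun a j S S' => (ih.w a j S S').comp htake⟩
    exact ih'.step (fun i => hlast.fst (P.sub_measurable i t)) (P.agent n) P.threshold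
      hlast.snd.fst hlast.snd.snd

/-- The memory and the active subsequences as functions of the information at the start of a
round. -/
lemma Setup.isMeasurable_elimState_fst (n : 𝒩) (t : ℕ) :
    ElimState.IsMeasurable fun z : Transcript 𝒳 d t × 𝒳 => P.elimState n t z.1 :=
  ⟨fun i a => measurable_fst ((P.isMeasurable_elimState n t).cand i a),
    fun a j S S' => ((P.isMeasurable_elimState n t).w a j S S').comp measurable_fst⟩

lemma Setup.measurableSet_union_eq (n : 𝒩) (t : ℕ) (U : Finset 𝒜) :
    MeasurableSet {z : Transcript 𝒳 d t × 𝒳 | P.union n t z.1 z.2 = U} := by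
  have hact : ∀ i, MeasurableSet {z : Transcript 𝒳 d t × 𝒳 | i ∈ {i | z.2 ∈ P.sub i t}} :=
    fun i => measurable_snd (P.sub_measurable i t)
  exact (P.isMeasurable_elimState_fst n t).measurableSet_union_eq hact U

lemma Setup.measurableSet_action_eq (n : 𝒩) (t : ℕ) (a : 𝒜) :
    MeasurableSet {z : (Transcript 𝒳 d t × 𝒳) × Cube d | P.action n t z.1.1 z.1.2 z.2 = a} := by
  have : {z : (Transcript 𝒳 d t × 𝒳) × Cube d | P.action n t z.1.1 z.1.2 z.2 = a} =
      ⋃ U : Finset 𝒜, {z | P.union n t z.1.1 z.1.2 = U} ∩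
        Prod.snd ⁻¹' {q | (P.agent n).cbr U q = a} := by
    ext z; simp [Setup.action]
  rw [this]
  exact MeasurableSet.iUnion fun U => (measurable_fst (P.measurableSet_union_eq n t U)).inter
    (measurable_snd ((P.agent n).cbr_measurable U a))

lemma Setup.measurable_events (e : 𝒩 × 𝒜 × Fin I) (t : ℕ) :
    Measurable fun z : (Transcript 𝒳 d t × 𝒳) × Cube d => P.events e t z.1.1 z.1.2 z.2 := by
  classical
  unfold Setup.events
  exact Measurable.ite (((measurable_snd.comp measurable_fst) (P.sub_measurable e.2.2 t)).inter
    (P.measurableSet_action_eq e.1 t e.2.1)) measurable_const measurable_const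

end Measurability

/-! ### The elimination algorithm along a fixed path. -/

section EliminationPath

variable {𝒳 : Type uX} [MeasurableSpace 𝒳] {𝒜 : Type uA} [Fintype 𝒜] {𝒩 : Type uN} [Fintype 𝒩]
  {d J I : ℕ} {L : ℝ} (P : Setup 𝒳 𝒜 𝒩 d J I L) (x : ℕ → 𝒳) (p y : ℕ → Cube d)

/-- The memory of agent `n` at the start of round `t` along a path. -/
def Setup.pathState (n : 𝒩) (t : ℕ) : ElimState 𝒜 I J :=
  P.elimState n t (pathTranscript x p y t)

/-- Round `t` counts for the violations of `a` attributed to `S'` on `S`. -/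
def Setup.Attributed (n : 𝒩) (a : 𝒜) (S S' : Fin I) (t : ℕ) : Prop :=
  P.pathAction x p y n t = a ∧ x t ∈ P.sub S t ∧
    (P.pathState x p y n t).Responsible {i | x t ∈ P.sub i t} a S'

lemma Setup.pathState_succ (n : 𝒩) (t : ℕ) :
    P.pathState x p y n (t + 1) = (P.pathState x p y n t).step (P.agent n) P.threshold
      {i | x t ∈ P.sub i t} (p t) (y t) := rfl

lemma Setup.pathState_succ_w (n : 𝒩) (t : ℕ) (a : 𝒜) (j : Fin J) (S S' : Fin I) :
    (P.pathState x p y n (t + 1)).w a j S S' = (P.pathState x p y n t).w a j S S' +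
      (open Classical in if P.Attributed x p y n a S S' t then (P.agent n).c j a (y t) else 0) := by
  classical
  rw [Setup.pathState_succ]
  refine ElimState.newW_eq.trans ?_
  congr 1
  exact if_congr Iff.rfl rfl rfl

lemma Setup.pathState_w (n : 𝒩) (t : ℕ) (a : 𝒜) (j : Fin J) (S S' : Fin I) :
    (P.pathState x p y n t).w a j S S' = ∑ s ∈ Finset.range t,
      (open Classical in if P.Attributed x p y n a S S' s then (P.agent n).c j a (y s) else 0) := by
  induction t with
  | zero => rfl
  | succ t ih => rw [P.pathState_succ_w, ih, Finset.sum_range_succ]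

lemma Setup.mem_cand_succ (n : 𝒩) (t : ℕ) (a : 𝒜) (S' : Fin I) :
    a ∈ (P.pathState x p y n (t + 1)).cand S' ↔ a ∈ (P.pathState x p y n t).cand S' ∧
      ¬ (P.pathAction x p y n t = a ∧
        (P.pathState x p y n t).Responsible {i | x t ∈ P.sub i t} a S' ∧
        ∃ j S, P.threshold S < (P.pathState x p y n (t + 1)).w a j S S') := by
  classical
  rw [P.pathState_succ]
  simp only [ElimState.step]
  change a ∈ (if _ then _ else _) ↔ _
  set b := (P.agent n).cbr ((P.pathState x p y n t).union {i | x t ∈ P.sub i t}) (p t) with hb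
  have hb' : P.pathAction x p y n t = b := rfl
  rw [hb']
  split_ifs with h
  · rw [Finset.mem_erase]
    constructor
    · rintro ⟨h1, h2⟩; exact ⟨h2, fun h3 => h1 h3.1.symm⟩
    · rintro ⟨h1, h2⟩
      refine ⟨fun h3 => h2 ⟨h3.symm, ?_⟩, h1⟩
      subst h3
      exact h
  · refine ⟨fun h1 => ⟨h1, fun h2 => h ?_⟩, fun h1 => h1.1⟩
    obtain ⟨h3, h4⟩ := h2
    subst h3
    exact h4

lemma Setup.mem_cand_of_le (n : 𝒩) {s t : ℕ} (hst : s ≤ t) {a : 𝒜} {S' : Fin I}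
    (h : a ∈ (P.pathState x p y n t).cand S') : a ∈ (P.pathState x p y n s).cand S' := by
  induction t, hst using Nat.le_induction with
  | base => exact h
  | succ t _ ih => exact ih ((P.mem_cand_succ x p y n t a S').1 h).1

/-- The violations of a removed action no longer change. -/
lemma Setup.exists_threshold_lt (n : 𝒩) (t : ℕ) {a : 𝒜} {S' : Fin I}
    (h : a ∉ (P.pathState x p y n t).cand S') :
    ∃ j S, P.threshold S < (P.pathState x p y n t).w a j S S' := by
  classical
  induction t with
  | zero => exact absurd (Finset.mem_univ a) h
  | succ t ih =>
    by_cases hc : a ∈ (P.pathState x p y n t).cand S'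
    · rw [P.mem_cand_succ] at h
      push Not at h
      exact (h hc).2.2
    · obtain ⟨j, S, hj⟩ := ih hc
      refine ⟨j, S, ?_⟩
      rw [P.pathState_succ_w, if_neg, add_zero]
      · exact hj
      · exact fun h' => hc h'.2.2.1.2

/-- The violation of `a` attributed to `S'` on `S`, centered by its conditional expectations. -/
def Setup.centeredViolation (D : ℕ → Measure (Cube d)) (n : 𝒩) (a : 𝒜) (j : Fin J) (S S' : Fin I)
    (t : ℕ) : ℝ :=
  open Classical in if P.Attributed x p y n a S S' t then
    (P.agent n).c j a (y t) - ∫ e, (P.agent n).c j a e ∂(D t) else 0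

/-- The indicator of the rounds that count for the violations attributed to `S'` on `S`. -/
def Setup.attributedIndicator (n : 𝒩) (a : 𝒜) (S S' : Fin I) (t : ℕ) : ℝ :=
  open Classical in if P.Attributed x p y n a S S' t then 1 else 0

/-- A removal would leave some attributed violation above its threshold up to time `T`. The
attributed rounds all lie in `S'`, where the subtracted means are at most `0`, so centering can only
increase the sum, and the centered sum would exceed the threshold too. -/
lemma Setup.mem_cand_of_expBenchmark {D : ℕ → Measure (Cube d)} {n : 𝒩} {a : 𝒜} {S' : Fin I}
    (ha : a ∈ expBenchmark (P.agent n) D (P.subseq x S'))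
    (h : ∀ j S, ∑ t ∈ Finset.range P.T, P.centeredViolation x p y D n a j S S' t ≤ P.threshold S)
    {t : ℕ} (ht : t ≤ P.T) : a ∈ (P.pathState x p y n t).cand S' := by
  classical
  refine P.mem_cand_of_le x p y n ht ?_
  by_contra hc
  obtain ⟨j, S, hj⟩ := P.exists_threshold_lt x p y n P.T hc
  refine absurd (hj.trans_le ?_) (not_lt.2 (h j S))
  rw [P.pathState_w]
  refine Finset.sum_le_sum fun s hs => ?_
  unfold Setup.centeredViolation
  split_ifs with hs'
  · have : s ∈ P.subseq x S' := by
      simp only [Setup.subseq, Finset.mem_filter]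
      exact ⟨hs, hs'.2.2.1.1⟩
    have := ha s this j
    linarith
  · exact le_rfl

lemma Setup.sum_attributedIndicator_le (n : 𝒩) (a : 𝒜) (S S' : Fin I) :
    ∑ t ∈ Finset.range P.T, P.attributedIndicator x p y n a S S' t ≤ (P.subseq x S).card := by
  classical
  unfold Setup.attributedIndicator Setup.subseq
  rw [Finset.sum_boole, Nat.cast_le]
  refine Finset.card_le_card fun t ht => ?_
  rw [Finset.mem_filter] at ht ⊢
  exact ⟨ht.1, ht.2.2.1⟩

end EliminationPath

/-! ### Concentration of the attributed violations. -/

section Interaction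

variable {𝒳 : Type uX} [MeasurableSpace 𝒳] {𝒜 : Type uA} [Fintype 𝒜] {𝒩 : Type uN} [Fintype 𝒩]
  {d J I : ℕ} {L : ℝ} {P : Setup 𝒳 𝒜 𝒩 d J I L}
  {Ω : Type uO} [mΩ : MeasurableSpace Ω] {μ : Measure Ω} {𝓕 : Filtration ℕ mΩ} {x : ℕ → Ω → 𝒳}
  {D : ℕ → Ω → Measure (Cube d)} {p y : ℕ → Ω → Cube d}

lemma Setup.IsInteraction.measurable_history (hI : P.IsInteraction μ 𝓕 x D p y) {t : ℕ}
    (ht : t < P.T) : Measurable[𝓕 t] fun ω =>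
      ((pathTranscript (fun s => x s ω) (fun s => p s ω) (fun s => y s ω) t, x t ω) :
        Transcript 𝒳 d t × 𝒳) := by
  refine Measurable.prodMk (@measurable_pi_lambda Ω (Fin t) _ (𝓕 t) _ _ fun s => ?_) (hI.x_measurable t ht)
  have hs : (s : ℕ) < P.T := s.isLt.trans ht
  exact Measurable.prodMk ((hI.x_measurable s hs).mono (𝓕.mono s.isLt.le) le_rfl)
    (Measurable.prodMk ((hI.p_measurable s hs).mono (𝓕.mono s.isLt) le_rfl)
      ((hI.y_measurable s hs).mono (𝓕.mono s.isLt) le_rfl))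

lemma Setup.measurableSet_attributed (n : 𝒩) (a : 𝒜) (S S' : Fin I) (t : ℕ) :
    MeasurableSet {z : (Transcript 𝒳 d t × 𝒳) × Cube d | P.action n t z.1.1 z.1.2 z.2 = a ∧
      z.1.2 ∈ P.sub S t ∧
      (P.elimState n t z.1.1).Responsible {i | z.1.2 ∈ P.sub i t} a S'} := by
  have hact : ∀ i, MeasurableSet {z : Transcript 𝒳 d t × 𝒳 | i ∈ {i | z.2 ∈ P.sub i t}} :=
    fun i => measurable_snd (P.sub_measurable i t)
  exact (P.measurableSet_action_eq n t a).inter (measurable_fst ((hact S).inter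
    ((P.isMeasurable_elimState_fst n t).measurableSet_responsible hact a S')))

/-- The information available when the outcome is drawn. -/
abbrev outcomeInfo (𝓕 : Filtration ℕ mΩ) (p : ℕ → Ω → Cube d) (t : ℕ) : MeasurableSpace Ω :=
  (𝓕 t) ⊔ MeasurableSpace.comap (p t) inferInstance

lemma Setup.IsInteraction.outcomeInfo_le (hI : P.IsInteraction μ 𝓕 x D p y) {t : ℕ}
    (ht : t < P.T) : outcomeInfo 𝓕 p t ≤ 𝓕 (t + 1) :=
  sup_le (𝓕.mono t.le_succ) (hI.p_measurable t ht).comap_le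

lemma Setup.IsInteraction.measurable_history_prediction (hI : P.IsInteraction μ 𝓕 x D p y) {t : ℕ}
    (ht : t < P.T) : Measurable[outcomeInfo 𝓕 p t] fun ω =>
      (((pathTranscript (fun s => x s ω) (fun s => p s ω) (fun s => y s ω) t, x t ω), p t ω) :
        (Transcript 𝒳 d t × 𝒳) × Cube d) :=
  Measurable.prodMk ((hI.measurable_history ht).mono le_sup_left le_rfl)
    ((comap_measurable (p t)).mono le_sup_right le_rfl)

lemma Setup.IsInteraction.measurableSet_attributed (hI : P.IsInteraction μ 𝓕 x D p y) {t : ℕ}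
    (ht : t < P.T) (n : 𝒩) (a : 𝒜) (S S' : Fin I) :
    MeasurableSet[outcomeInfo 𝓕 p t]
      {ω | P.Attributed (fun s => x s ω) (fun s => p s ω) (fun s => y s ω) n a S S' t} :=
  hI.measurable_history_prediction ht (P.measurableSet_attributed n a S S' t)

lemma measurable_integral_of_measurable {α E : Type*} [MeasurableSpace α] [MeasurableSpace E]
    {κ : α → Measure E} (hκ : Measurable κ) (hp : ∀ a, IsProbabilityMeasure (κ a)) {f : E → ℝ}
    (hf : Measurable f) : Measurable fun a => ∫ e, f e ∂κ a := by
  let K : Kernel α E := ⟨κ, hκ⟩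
  have : IsMarkovKernel K := ⟨hp⟩
  exact (hf.stronglyMeasurable.integral_kernel (κ := K)).measurable

lemma measurable_centered_exp {α E : Type*} [MeasurableSpace α] [MeasurableSpace E]
    {κ : α → Measure E} (hκ : Measurable κ) (hp : ∀ a, IsProbabilityMeasure (κ a)) {f : E → ℝ}
    (hf : Measurable f) {A : Set α} (hA : MeasurableSet A) {g : α → ℝ≥0∞} (hg : Measurable g)
    (l : ℝ) [DecidablePred (· ∈ A)] :
    Measurable fun z : α × E => g z.1 * ENNReal.ofReal (Real.exp
      (l * (if z.1 ∈ A then f z.2 - ∫ e, f e ∂κ z.1 else 0) -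
        l ^ 2 / 2 * (if z.1 ∈ A then 1 else 0))) := by
  have hi := measurable_integral_of_measurable hκ hp hf
  have hA' : MeasurableSet {z : α × E | z.1 ∈ A} := measurable_fst hA
  refine (hg.comp measurable_fst).mul (ENNReal.measurable_ofReal.comp (Real.measurable_exp.comp ?_))
  refine (Measurable.const_mul (Measurable.ite hA' ?_ measurable_const) _).sub
    (Measurable.const_mul (Measurable.ite hA' measurable_const measurable_const) _)
  exact (hf.comp measurable_snd).sub (hi.comp measurable_fst)

/-- One step of the exponential supermartingale: Hoeffding's lemma on `A`, while off `A` the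
exponential factor equals one and no variance is spent. -/
lemma lintegral_centered_exp_le {α E : Type*} [MeasurableSpace E] {κ : α → Measure E}
    (hp : ∀ a, IsProbabilityMeasure (κ a)) {f : E → ℝ} (hf : Measurable f)
    (hb : ∀ e, f e ∈ Set.Icc (-1 : ℝ) 1) {A : Set α} {g : α → ℝ≥0∞}
    (l : ℝ) [DecidablePred (· ∈ A)] (a : α) :
    ∫⁻ e, g a * ENNReal.ofReal (Real.exp (l * (if a ∈ A then f e - ∫ e, f e ∂κ a else 0) -
        l ^ 2 / 2 * (if a ∈ A then 1 else 0))) ∂κ a ≤ g a := by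
  have := hp a
  by_cases ha : a ∈ A
  · simp only [ha, if_true]
    rw [lintegral_const_mul _ (by fun_prop)]
    have := lintegral_exp_centered_le (κ a) hf (a := -1) (fun e => by
      have := hb e; exact ⟨this.1, by linarith [this.2]⟩) l
    calc _ ≤ g a * 1 := by gcongr; simpa using this
      _ = g a := mul_one _
  · simp [ha]

/-- Whether a round is attributed is settled by the past, the feature and the prediction, hence
before the outcome is drawn. The increments are thus conditionally centered, and their variance
proxy counts the attributed rounds, which are at most `|S|` and not merely at most `T`. -/
lemma Setup.IsInteraction.measure_centeredViolation_gt_le [IsProbabilityMeasure μ]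
    (hI : P.IsInteraction μ 𝓕 x D p y) (n : 𝒩) (a : 𝒜) (j : Fin J) (S S' : Fin I) {τ : ℝ}
    (hτ : 0 ≤ τ) (hlen : 0 < P.len S) :
    μ {ω | τ < ∑ t ∈ Finset.range P.T, P.centeredViolation (fun s => x s ω) (fun s => p s ω)
      (fun s => y s ω) (fun s => D s ω) n a j S S' t} ≤
      ENNReal.ofReal (Real.exp (-(τ ^ 2 / (2 * P.len S)))) := by
  classical
  set X : ℕ → Ω → ℝ := fun t ω => P.centeredViolation (fun s => x s ω) (fun s => p s ω)
      (fun s => y s ω) (fun s => D s ω) n a j S S' t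
  set b : ℕ → Ω → ℝ := fun t ω => P.attributedIndicator (fun s => x s ω) (fun s => p s ω)
      (fun s => y s ω) n a S S' t
  have hXm : ∀ t < P.T, Measurable[𝓕 (t + 1)] (X t) := by
    intro t ht
    have h1 := hI.outcomeInfo_le ht _ (hI.measurableSet_attributed ht n a S S')
    refine Measurable.ite h1 (Measurable.sub ?_ ?_) measurable_const
    · exact ((P.agent n).c_measurable j a).comp (hI.y_measurable t ht)
    · exact @measurable_integral_of_measurable _ _ (𝓕 (t + 1)) _ _
        ((hI.D_measurable t ht).mono (𝓕.mono t.le_succ) le_rfl) (hI.D_prob t ht) _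
        ((P.agent n).c_measurable j a)
  have hbm : ∀ t < P.T, Measurable[𝓕 (t + 1)] (b t) := by
    intro t ht
    have h1 := hI.outcomeInfo_le ht _ (hI.measurableSet_attributed ht n a S S')
    exact Measurable.ite h1 measurable_const measurable_const
  refine measure_sum_gt_le P.T X b (by exact_mod_cast hlen) hτ (fun l hl => ?_) ?_
    (fun t ht => (hXm t ht).mono (𝓕.le _) le_rfl) (fun t ht => (hbm t ht).mono (𝓕.le _) le_rfl)
  · refine lintegral_exp_sum_le_one 𝓕 P.T (fun t ω => l * X t ω - l ^ 2 / 2 * b t ω)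
      (fun t ht => ((hXm t ht).const_mul _).sub ((hbm t ht).const_mul _)) fun t ht f hf => ?_
    have hle := (hI.outcomeInfo_le ht).trans (𝓕.le _)
    have hD : Measurable[outcomeInfo 𝓕 p t] (D t) := (hI.D_measurable t ht).mono le_sup_left le_rfl
    have hf' : Measurable[outcomeInfo 𝓕 p t] f := hf.mono le_sup_left le_rfl
    have hc := (P.agent n).c_measurable j a
    have hA := hI.measurableSet_attributed ht n a S S'
    have hdis := lintegral_of_condExp_law hle hD (hI.D_prob t ht)
      ((hI.y_measurable t ht).mono (𝓕.le _) le_rfl) (hI.y_law t ht)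
      (@measurable_centered_exp Ω _ (outcomeInfo 𝓕 p t) _ _ hD (hI.D_prob t ht) _ hc _ hA _ hf' l _)
    refine (le_of_eq hdis).trans (lintegral_mono fun ω => ?_)
    exact lintegral_centered_exp_le (hI.D_prob t ht) hc ((P.agent n).c_mem j a) l ω
  · filter_upwards [hI.length] with ω hω
    rw [← hω S]
    exact P.sum_attributedIndicator_le _ _ _ n a S S'

lemma Setup.IsInteraction.measure_threshold_lt_le [IsProbabilityMeasure μ]
    (hI : P.IsInteraction μ 𝓕 x D p y) (hδ : 0 < P.δ) (hδ1 : P.δ < 1) (n : 𝒩) (a : 𝒜) (j : Fin J)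
    (S S' : Fin I) :
    μ {ω | P.threshold S < ∑ t ∈ Finset.range P.T, P.centeredViolation (fun s => x s ω)
      (fun s => p s ω) (fun s => y s ω) (fun s => D s ω) n a j S S' t} ≤
      ENNReal.ofReal ((P.δ / (Fintype.card (𝒩 × 𝒜 × Fin J × Fin I × Fin I) : ℝ)) ^ 2) := by
  classical
  have hτ : 0 ≤ P.threshold S := by unfold Setup.threshold; positivity
  set N : ℝ := (Fintype.card (𝒩 × 𝒜 × Fin J × Fin I × Fin I) : ℝ) with hN
  have hN1 : 1 ≤ N := by
    rw [hN, Nat.one_le_cast]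
    exact Fintype.card_pos_iff.2 ⟨(n, a, j, S, S')⟩
  -- For an empty subsequence no round is attributed almost surely, so the sum vanishes and cannot
  -- exceed the nonnegative threshold.
  rcases Nat.eq_zero_or_pos (P.len S) with h0 | hpos
  · refine le_trans (le_of_eq ?_) zero_le
    rw [measure_eq_zero_iff_ae_notMem]
    filter_upwards [hI.length] with ω hω
    refine not_lt.2 (le_trans (le_of_eq ?_) hτ)
    refine Finset.sum_eq_zero fun t ht => ?_
    refine if_neg fun h => ?_
    have hS := hω S
    rw [h0, Finset.card_eq_zero] at hS
    refine Finset.notMem_empty t (hS ▸ ?_)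
    exact Finset.mem_filter.2 ⟨ht, h.2.1⟩
  · refine (hI.measure_centeredViolation_gt_le n a j S S' hτ hpos).trans
      (ENNReal.ofReal_le_ofReal ?_)
    have hlen : (1 : ℝ) ≤ P.len S := by exact_mod_cast hpos
    set Z : ℝ := N * P.len S / P.δ with hZ
    have hZN : N / P.δ ≤ Z := by rw [hZ]; gcongr; nlinarith
    have hZ1 : 1 ≤ Z := le_trans ((one_le_div hδ).2 (by linarith)) hZN
    have harg : (Fintype.card 𝒜 : ℝ) * Fintype.card 𝒩 * (I : ℝ) ^ 2 * J * P.len S / P.δ = Z := by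
      rw [hZ, hN]
      simp only [Fintype.card_prod, Fintype.card_fin]
      push_cast
      ring
    have hlog : 0 ≤ Real.log Z := Real.log_nonneg hZ1
    -- The constant `4` in the threshold gives `16 / 2 = 8`. A factor `2` would suffice here; it
    -- produces the square in the conclusion.
    have hsq : P.threshold S ^ 2 / (2 * P.len S) = 8 * Real.log Z := by
      unfold Setup.threshold
      rw [harg, mul_pow, Real.sq_sqrt (by positivity)]
      field_simp
      ring
    have hexp : Real.exp (-Real.log Z) ≤ P.δ / N := by
      rw [Real.exp_neg, Real.exp_log (by linarith), ← inv_div N P.δ]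
      exact inv_anti₀ (by positivity) hZN
    calc _ ≤ Real.exp (-Real.log Z) ^ 2 := by
          rw [hsq, ← Real.exp_nat_mul]
          refine Real.exp_le_exp.2 ?_
          push_cast
          linarith
      _ ≤ _ := by gcongr

/-- Except with probability `δ / |𝒜|`, no centered violation exceeds its threshold. -/
lemma Setup.IsInteraction.measure_exists_threshold_lt_le [IsProbabilityMeasure μ]
    (hI : P.IsInteraction μ 𝓕 x D p y) (hδ : 0 < P.δ) (hδ1 : P.δ < 1) :
    μ {ω | ∃ n a j S S', P.threshold S < ∑ t ∈ Finset.range P.T, P.centeredViolation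
      (fun s => x s ω) (fun s => p s ω) (fun s => y s ω) (fun s => D s ω) n a j S S' t} ≤
      ENNReal.ofReal (P.δ / Fintype.card 𝒜) := by
  set ι := 𝒩 × 𝒜 × Fin J × Fin I × Fin I with hι
  set B : ι → Set Ω := fun k => {ω | P.threshold k.2.2.2.1 < ∑ t ∈ Finset.range P.T,
    P.centeredViolation (fun s => x s ω) (fun s => p s ω) (fun s => y s ω) (fun s => D s ω)
      k.1 k.2.1 k.2.2.1 k.2.2.2.1 k.2.2.2.2 t}
  have hsub : {ω | ∃ n a j S S', P.threshold S < ∑ t ∈ Finset.range P.T, P.centeredViolation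
      (fun s => x s ω) (fun s => p s ω) (fun s => y s ω) (fun s => D s ω) n a j S S' t} ⊆
      ⋃ k, B k := by
    rintro ω ⟨n, a, j, S, S', h⟩
    exact Set.mem_iUnion.2 ⟨(n, a, j, S, S'), h⟩
  refine (measure_mono hsub).trans ((measure_iUnion_fintype_le μ B).trans ?_)
  rcases isEmpty_or_nonempty ι with hE | hE
  · simp
  obtain ⟨⟨n, a, j, S, S'⟩⟩ := id hE
  -- The square survives the union bound as `δ² / |ι| ≤ δ / |𝒜|`. The gain of `1 / |𝒜|` later leaves
  -- room in the failure probability for the sampling errors.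
  calc ∑ k, μ (B k) ≤ ∑ _k : ι, ENNReal.ofReal ((P.δ / (Fintype.card ι : ℝ)) ^ 2) :=
        Finset.sum_le_sum fun k _ => hI.measure_threshold_lt_le hδ hδ1 _ _ _ _ _
    _ = ENNReal.ofReal (Fintype.card ι * (P.δ / (Fintype.card ι : ℝ)) ^ 2) := by
        rw [Finset.sum_const, Finset.card_univ, nsmul_eq_mul, ENNReal.ofReal_mul (by positivity),
          ENNReal.ofReal_natCast]
    _ ≤ _ := by
        refine ENNReal.ofReal_le_ofReal ?_
        have hι1 : (0 : ℝ) < Fintype.card ι := by exact_mod_cast Fintype.card_pos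
        have hA : (0 : ℝ) < Fintype.card 𝒜 := by exact_mod_cast Fintype.card_pos_iff.2 ⟨a⟩
        have hle : (Fintype.card 𝒜 : ℝ) ≤ Fintype.card ι := by
          rw [Nat.cast_le]
          exact Fintype.card_le_of_surjective (fun k : ι => k.2.1) fun b => ⟨(n, b, j, S, S'), rfl⟩
        calc Fintype.card ι * (P.δ / (Fintype.card ι : ℝ)) ^ 2
            = P.δ * P.δ / Fintype.card ι := by field_simp
          _ ≤ P.δ * 1 / Fintype.card ι := by gcongr
          _ ≤ P.δ / Fintype.card 𝒜 := by rw [mul_one]; gcongr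

end Interaction

/-! ### Linear Lipschitz utilities and elementary regret bounds. -/

section Regret

variable {𝒜 : Type uA} {d J : ℕ} {L : ℝ}

lemma Cube.norm_le_one (y : Cube d) : ‖(y : Fin d → ℝ)‖ ≤ 1 := by
  refine (pi_norm_le_iff_of_nonneg zero_le_one).2 fun i => ?_
  rw [Real.norm_eq_abs, abs_le]
  exact ⟨by linarith [y.2.1 i, show (0 : Fin d → ℝ) i = 0 from rfl], y.2.2 i⟩

lemma Agent.u_zero (ag : Agent 𝒜 d J L) (a : 𝒜) : ag.u a ⟨0, le_rfl, zero_le_one⟩ = 0 := by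
  have := ag.u_linear a 0 0 ⟨0, le_rfl, zero_le_one⟩ ⟨0, le_rfl, zero_le_one⟩
    ⟨0, le_rfl, zero_le_one⟩ (by simp)
  simpa using this

/-- Linearity forces `u(b, 0) = 0`, so the Lipschitz condition bounds `u(b, y)` by `L`. This makes
the trivial regret bound proportional to `L`, as the final bound requires. -/
lemma Agent.u_sub_le (ag : Agent 𝒜 d J L) (hL : 0 ≤ L) (a b : 𝒜) (y : Cube d) :
    ag.u b y - ag.u a y ≤ L := by
  have h1 := (abs_le.1 (ag.u_lipschitz b y ⟨0, le_rfl, zero_le_one⟩)).2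
  rw [ag.u_zero, sub_zero] at h1
  have h2 : ‖(y : Fin d → ℝ) - 0‖ ≤ 1 := by rw [sub_zero]; exact Cube.norm_le_one y
  have h3 := (ag.u_mem a y).1
  nlinarith

/-- Linearity is available only for combinations inside the cube. Scaled partial sums stay there
because all summands are nonnegative and the full scaled sum `z` lies in the cube. -/
lemma Agent.u_smul_sum (ag : Agent 𝒜 d J L) (a : 𝒜) (y : ℕ → Cube d) (F : Finset ℕ) {c : ℝ}
    (hc : 0 ≤ c) (z : Cube d) (hz : (z : Fin d → ℝ) = c • ∑ t ∈ F, (y t : Fin d → ℝ)) :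
    ag.u a z = c * ∑ t ∈ F, ag.u a (y t) := by
  classical
  induction F using Finset.induction_on generalizing z with
  | empty =>
    have : z = ⟨0, le_rfl, zero_le_one⟩ := Subtype.ext (by simpa using hz)
    rw [this, ag.u_zero]; simp
  | insert s F hs ih =>
    rw [Finset.sum_insert hs, smul_add] at hz
    have h0 : 0 ≤ c • ∑ t ∈ F, (y t : Fin d → ℝ) :=
      smul_nonneg hc (Finset.sum_nonneg fun t _ => (y t).2.1)
    have h1 : c • ∑ t ∈ F, (y t : Fin d → ℝ) ≤ 1 := by
      refine le_trans ?_ z.2.2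
      rw [hz]
      exact le_add_of_nonneg_left (smul_nonneg hc (y s).2.1)
    rw [ag.u_linear a c 1 (y s) ⟨_, h0, h1⟩ z (by rw [hz, one_smul]), ih ⟨_, h0, h1⟩ rfl,
      Finset.sum_insert hs]
    ring

/-- The advantage of `b` over `a` on the outcomes is at most that on the predictions, up to the
bias of the predictions. -/
lemma Agent.sum_u_sub_le (ag : Agent 𝒜 d J L) (a b : 𝒜) (p y : ℕ → Cube d) (F : Finset ℕ) :
    ∑ t ∈ F, (ag.u b (y t) - ag.u a (y t)) ≤ ∑ t ∈ F, (ag.u b (p t) - ag.u a (p t)) +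
      2 * L * ‖∑ t ∈ F, ((p t : Fin d → ℝ) - (y t : Fin d → ℝ))‖ := by
  rcases F.eq_empty_or_nonempty with rfl | hF
  · simp
  have hK : (0 : ℝ) < F.card := by exact_mod_cast hF.card_pos
  -- The sums may leave the cube but their averages do not. The Lipschitz condition is applied to
  -- the averages, once for `a` and once for `b`, and the result is multiplied back by `|F|`.
  set c : ℝ := (F.card : ℝ)⁻¹ with hc
  have hc0 : 0 ≤ c := by positivity
  have hmean : ∀ w : ℕ → Cube d, ∃ z : Cube d, (z : Fin d → ℝ) = c • ∑ t ∈ F, (w t : Fin d → ℝ) := by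
    intro w
    refine ⟨⟨c • ∑ t ∈ F, (w t : Fin d → ℝ), smul_nonneg hc0
      (Finset.sum_nonneg fun t _ => (w t).2.1), ?_⟩, rfl⟩
    calc c • ∑ t ∈ F, (w t : Fin d → ℝ) ≤ c • ∑ _t ∈ F, (1 : Fin d → ℝ) := by
          gcongr with t _; exact (w t).2.2
      _ = 1 := by
          rw [Finset.sum_const, ← Nat.cast_smul_eq_nsmul ℝ, smul_smul, hc,
            inv_mul_cancel₀ hK.ne', one_smul]
  obtain ⟨zp, hzp⟩ := hmean p
  obtain ⟨zy, hzy⟩ := hmean y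
  have hnorm : ‖(zp : Fin d → ℝ) - zy‖ =
      c * ‖∑ t ∈ F, ((p t : Fin d → ℝ) - (y t : Fin d → ℝ))‖ := by
    rw [hzp, hzy, ← smul_sub, ← Finset.sum_sub_distrib, norm_smul, Real.norm_of_nonneg hc0]
  have hb := (abs_le.1 (ag.u_lipschitz b zp zy)).1
  have ha := (abs_le.1 (ag.u_lipschitz a zp zy)).2
  rw [hnorm, ag.u_smul_sum _ _ _ hc0 _ hzp, ag.u_smul_sum _ _ _ hc0 _ hzy] at ha hb
  simp only [Finset.sum_sub_distrib]
  refine le_of_mul_le_mul_left ?_ (inv_pos.2 hK)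
  rw [← hc]
  simp only [Finset.sum_sub_distrib] at ha hb
  linarith

variable {B : Set 𝒜} {S : Finset ℕ} {a : ℕ → 𝒜} {y : ℕ → Cube d} [Finite 𝒜]

lemma bddAbove_swapRegret (u : 𝒜 → Cube d → ℝ) :
    BddAbove (Set.range fun φ : 𝒜 → B => ∑ t ∈ S, (u (φ (a t)) (y t) - u (a t) (y t))) :=
  (Set.finite_range _).bddAbove

/-- External deviations are the constant maps `φ`. -/
lemma extRegret_le_swapRegret (u : 𝒜 → Cube d → ℝ) (hB : B.Nonempty) :
    extRegret u B S a y ≤ swapRegret u B S a y := by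
  have := hB.to_subtype
  exact ciSup_le fun b => le_ciSup (bddAbove_swapRegret u) fun _ : 𝒜 => b

lemma Agent.swapRegret_le_card (ag : Agent 𝒜 d J L) (hL : 0 ≤ L) (hB : B.Nonempty) :
    swapRegret ag.u B S a y ≤ L * S.card := by
  have := hB.to_subtype
  refine ciSup_le fun φ => ?_
  calc _ ≤ ∑ _t ∈ S, L := Finset.sum_le_sum fun t _ => ag.u_sub_le hL _ _ _
    _ = L * S.card := by rw [Finset.sum_const, nsmul_eq_mul, mul_comm]

lemma swapRegret_le_zero_of_subsingleton (u : 𝒜 → Cube d → ℝ) (h : Subsingleton 𝒜)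
    (hB : B.Nonempty) : swapRegret u B S a y ≤ 0 := by
  have := hB.to_subtype
  refine ciSup_le fun φ => le_of_eq (Finset.sum_eq_zero fun t _ => ?_)
  rw [Subsingleton.elim (φ (a t) : 𝒜) (a t), sub_self]

end Regret

/-! ### From small bias to small swap regret. -/

section Calibration

variable {𝒳 : Type uX} [MeasurableSpace 𝒳] {𝒜 : Type uA} [Fintype 𝒜] {𝒩 : Type uN} [Fintype 𝒩]
  {d J I : ℕ} {L : ℝ} (P : Setup 𝒳 𝒜 𝒩 d J I L) {x : ℕ → 𝒳} {p y : ℕ → Cube d}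

lemma Setup.mem_pathUnion {n : 𝒩} {i : Fin I} {b : 𝒜} {t : ℕ} (ht : t ∈ P.subseq x i)
    (hb : b ∈ (P.pathState x p y n t).cand i) :
    b ∈ P.union n t (pathTranscript x p y t) (x t) := by
  classical
  exact ElimState.mem_union.2 ⟨i, (Finset.mem_filter.1 ht).2, hb⟩

/-- Low bias on the rounds in which an agent plays each action implies low swap regret against
benchmarks that are never eliminated. -/
lemma Setup.swapRegret_le_of_bias_le {β : ℝ → ℝ} {n : 𝒩} {i : Fin I}
    (h : open Classical in ∀ a : 𝒜,
      ‖∑ t ∈ (P.subseq x i).filter (fun t => P.pathAction x p y n t = a),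
        ((p t : Fin d → ℝ) - (y t : Fin d → ℝ))‖
      ≤ β (((P.subseq x i).filter (fun t => P.pathAction x p y n t = a)).card : ℝ))
    (hL : 0 ≤ L) (hβ : ConcaveOn ℝ (Set.Ici 0) β) {B : Set 𝒜} (hB : B.Nonempty)
    (hcand : ∀ b ∈ B, ∀ t ∈ P.subseq x i, b ∈ (P.pathState x p y n t).cand i) :
    swapRegret (P.agent n).u B (P.subseq x i) (P.pathAction x p y n) y ≤
      2 * L * (Fintype.card 𝒜 : ℝ) *
        β (((P.subseq x i).card : ℝ) / (Fintype.card 𝒜 : ℝ)) := by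
  classical
  have := hB.to_subtype
  have hA : 0 < Fintype.card 𝒜 := Fintype.card_pos_iff.2 ⟨hB.some⟩
  have hA' : (0 : ℝ) < Fintype.card 𝒜 := by exact_mod_cast hA
  set S := P.subseq x i with hS
  set act := P.pathAction x p y n with hact
  refine ciSup_le fun φ => ?_
  -- On the rounds with a given played action the deviation `φ` is constant, so each fibre compares
  -- two fixed actions.
  have hfib : ∑ t ∈ S, ((P.agent n).u (φ (act t)) (y t) - (P.agent n).u (act t) (y t)) =
      ∑ a : 𝒜, ∑ t ∈ S.filter (fun t => act t = a),
        ((P.agent n).u (φ a) (y t) - (P.agent n).u a (y t)) := by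
    rw [← Finset.sum_fiberwise S act]
    refine Finset.sum_congr rfl fun a _ => Finset.sum_congr rfl fun t ht => ?_
    rw [(Finset.mem_filter.1 ht).2]
  have hone : ∀ a : 𝒜, ∑ t ∈ S.filter (fun t => act t = a),
        ((P.agent n).u (φ a) (y t) - (P.agent n).u a (y t)) ≤
      2 * L * β ((S.filter (fun t => act t = a)).card : ℝ) := by
    intro a
    refine ((P.agent n).sum_u_sub_le a (φ a) p y _).trans ?_
    -- The benchmark `φ a` was never eliminated, so it lies in `U_t` and cannot beat the best
    -- response on the prediction.
    have h1 : ∑ t ∈ S.filter (fun t => act t = a),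
        ((P.agent n).u (φ a) (p t) - (P.agent n).u a (p t)) ≤ 0 := by
      refine Finset.sum_nonpos fun t ht => ?_
      rw [Finset.mem_filter] at ht
      have := (P.agent n).cbr_max _ (p t) _
        (P.mem_pathUnion ht.1 (hcand _ (φ a).2 t ht.1))
      rw [← ht.2]
      have h2 : act t = (P.agent n).cbr (P.union n t (pathTranscript x p y t) (x t)) (p t) := rfl
      rw [ht.2] at h2 ⊢
      rw [← h2] at this
      linarith
    have h2 := h a
    have h3 : ‖∑ t ∈ S.filter (fun t => act t = a), ((p t : Fin d → ℝ) - (y t : Fin d → ℝ))‖ ≤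
        β ((S.filter (fun t => act t = a)).card : ℝ) := by
      convert h2 using 3
    have : 2 * L * ‖∑ t ∈ S.filter (fun t => act t = a),
        ((p t : Fin d → ℝ) - (y t : Fin d → ℝ))‖ ≤
        2 * L * β ((S.filter (fun t => act t = a)).card : ℝ) := by gcongr
    linarith
  -- Uniform weights: the fibre sizes add up to `|S|`, so their mean is `|S| / |𝒜|`.
  have hjensen := hβ.le_map_sum (t := Finset.univ) (w := fun _ : 𝒜 => (Fintype.card 𝒜 : ℝ)⁻¹)
    (p := fun a => ((S.filter (fun t => act t = a)).card : ℝ)) (fun _ _ => by positivity)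
    (by rw [Finset.sum_const, Finset.card_univ, nsmul_eq_mul, mul_inv_cancel₀ hA'.ne'])
    (fun a _ => Set.mem_Ici.2 (Nat.cast_nonneg _))
  simp only [smul_eq_mul, ← Finset.mul_sum] at hjensen
  have hcard : ∑ a : 𝒜, ((S.filter (fun t => act t = a)).card : ℝ) = S.card := by
    rw [← Nat.cast_sum, ← Finset.card_eq_sum_card_fiberwise (f := act) (t := Finset.univ)
      (fun _ _ => Finset.mem_coe.2 (Finset.mem_univ _))]
  rw [hcard, inv_mul_eq_div, inv_mul_eq_div, div_le_iff₀ hA'] at hjensen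
  calc _ = _ := hfib
    _ ≤ ∑ a : 𝒜, 2 * L * β ((S.filter (fun t => act t = a)).card : ℝ) :=
        Finset.sum_le_sum fun a _ => hone a
    _ = 2 * L * ∑ a : 𝒜, β ((S.filter (fun t => act t = a)).card : ℝ) := by rw [Finset.mul_sum]
    _ ≤ 2 * L * (β (S.card / Fintype.card 𝒜) * Fintype.card 𝒜) := by gcongr
    _ = _ := by ring

end Calibration

/-! ### The high-probability bound for decision-calibrated predictions. -/

section DecisionCalibrated

variable {𝒳 : Type uX} [MeasurableSpace 𝒳] {𝒜 : Type uA} [Fintype 𝒜] {𝒩 : Type uN} [Fintype 𝒩]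
  {d J I : ℕ} {L : ℝ} {P : Setup 𝒳 𝒜 𝒩 d J I L}
  {Ω : Type uO} [mΩ : MeasurableSpace Ω] {μ : Measure Ω} {𝓕 : Filtration ℕ mΩ} {x : ℕ → Ω → 𝒳}
  {D : ℕ → Ω → Measure (Cube d)} {p y : ℕ → Ω → Cube d}

/-- The good event is not assumed measurable, so subadditivity of the outer measure takes the place
of the complement formula. -/
lemma le_measure_of_compl_subset [IsProbabilityMeasure μ] {G Bad : Set Ω} {ε : ℝ} (hε : 0 ≤ ε)
    (hBad : μ Bad ≤ ENNReal.ofReal ε) (h : Gᶜ ⊆ Bad) : ENNReal.ofReal (1 - ε) ≤ μ G := by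
  rw [ENNReal.ofReal_sub _ hε, ENNReal.ofReal_one, tsub_le_iff_right]
  calc (1 : ℝ≥0∞) = μ Set.univ := measure_univ.symm
    _ ≤ μ (G ∪ Bad) := measure_mono fun ω _ => by
        by_cases hω : ω ∈ G
        · exact Or.inl hω
        · exact Or.inr (h hω)
    _ ≤ μ G + μ Bad := measure_union_le _ _
    _ ≤ μ G + ENNReal.ofReal ε := by gcongr

/-- With probability at least `1 - δ`, decision calibration implies low swap regret against the
actions that satisfy the constraints in expectation. -/
lemma Setup.IsInteraction.swapRegret_le_of_isDecisionCalibrated [IsProbabilityMeasure μ]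
    (hI : P.IsInteraction μ 𝓕 x D p y) (hL : 0 ≤ L) (hδ : 0 < P.δ) (hδ1 : P.δ < 1) {β : ℝ → ℝ}
    (hβ : ConcaveOn ℝ (Set.Ici 0) β) :
    ENNReal.ofReal (1 - P.δ) ≤ μ {ω |
      P.IsDecisionCalibrated β (fun t => x t ω) (fun t => p t ω) (fun t => y t ω) →
      ∀ (n : 𝒩) (i : Fin I),
        (expBenchmark (P.agent n) (fun t => D t ω) (P.subseq (fun t => x t ω) i)).Nonempty →
        swapRegret (P.agent n).u
            (expBenchmark (P.agent n) (fun t => D t ω) (P.subseq (fun t => x t ω) i))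
            (P.subseq (fun t => x t ω) i)
            (P.pathAction (fun t => x t ω) (fun t => p t ω) (fun t => y t ω) n)
            (fun t => y t ω)
          ≤ 2 * L * (Fintype.card 𝒜 : ℝ) *
              β (((P.subseq (fun t => x t ω) i).card : ℝ) / (Fintype.card 𝒜 : ℝ))} := by
  have hle : P.δ / Fintype.card 𝒜 ≤ P.δ := by
    rcases Nat.eq_zero_or_pos (Fintype.card 𝒜) with h | h
    · rw [h]; simpa using hδ.le
    · exact div_le_self hδ.le (by exact_mod_cast h)
  refine le_measure_of_compl_subset hδ.le ((hI.measure_exists_threshold_lt_le hδ hδ1).trans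
    (ENNReal.ofReal_le_ofReal hle)) fun ω hω => ?_
  by_contra hgood
  refine hω fun hcal n i hne => P.swapRegret_le_of_bias_le (fun a => hcal i a n) hL hβ hne fun b hb t ht => ?_
  have ht' : t < P.T := by
    classical exact Finset.mem_range.1 (Finset.mem_filter.1 ht).1
  refine P.mem_cand_of_expBenchmark _ _ _ hb (fun j S => ?_) ht'.le
  by_contra hlt
  exact hgood ⟨n, b, j, S, i, not_le.1 hlt⟩

end DecisionCalibrated

/-! ### The minmax argument for a single round. -/

section Minmax

variable {d : ℕ}

instance : CompactSpace (Cube d) := isCompact_iff_compactSpace.1 isCompact_Icc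

instance : Nonempty (Cube d) := ⟨⟨0, le_rfl, zero_le_one⟩⟩

lemma Cube.abs_sub_le_one (p y : Cube d) (i : Fin d) :
    |(p : Fin d → ℝ) i - (y : Fin d → ℝ) i| ≤ 1 := by
  have h1 : 0 ≤ (p : Fin d → ℝ) i := p.2.1 i
  have h2 : (p : Fin d → ℝ) i ≤ 1 := p.2.2 i
  have h3 : 0 ≤ (y : Fin d → ℝ) i := y.2.1 i
  have h4 : (y : Fin d → ℝ) i ≤ 1 := y.2.2 i
  rw [abs_le]
  constructor <;> linarith

/-- The minmax argument of unbiased prediction: some distribution of the predictions makes the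
weighted bias at most `ε` against every outcome. -/
lemma exists_distribution_bias_le {K : Type*} [Fintype K] (a : K → Cube d → ℝ) (i : K → Fin d)
    (ha : ∀ p, ∑ k, |a k p| ≤ 1) {ε : ℝ} (hε : 0 < ε) :
    ∃ ν : Measure (Cube d), IsProbabilityMeasure ν ∧ ∀ y : Cube d,
      ∑ k, ∫ p, a k p * ((p : Fin d → ℝ) (i k) - (y : Fin d → ℝ) (i k)) ∂ν ≤ ε := by
  classical
  -- The coefficients `a k p` may be discontinuous in `p`. Restricting predictions to a finite
  -- `ε`-net turns the payoff `f` into a continuous function on simplex times cube, linear in the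
  -- mixture and affine in the outcome, so Sion's theorem applies.
  obtain ⟨G, -, hGfin, hG⟩ := (isCompact_univ (X := Cube d)).finite_cover_balls hε
  have : Fintype G := hGfin.fintype
  have hnet : ∀ z : Cube d, ∃ p : G, dist z (p : Cube d) < ε := by
    intro z
    have := hG (Set.mem_univ z)
    simp only [Set.mem_iUnion, Metric.mem_ball, exists_prop] at this
    obtain ⟨p, hp, hz⟩ := this
    exact ⟨⟨p, hp⟩, hz⟩
  let f : (G → ℝ) → (Fin d → ℝ) → ℝ := fun w y =>
    ∑ p : G, w p * ∑ k, a k p * (((p : Cube d) : Fin d → ℝ) (i k) - y (i k))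
  have hG0 : Nonempty G := (hnet ⟨0, le_rfl, zero_le_one⟩).nonempty
  obtain ⟨w, hw, y₀, hy₀, hsaddle⟩ := Sion.exists_isSaddlePointOn
    (X := stdSimplex ℝ G) (Y := Set.Icc (0 : Fin d → ℝ) 1) (f := f)
    ⟨_, single_mem_stdSimplex ℝ hG0.some⟩ (convex_stdSimplex ℝ G) (isCompact_stdSimplex ℝ G)
    (fun y _ => (Continuous.lowerSemicontinuous (by fun_prop)).lowerSemicontinuousOn _)
    (fun y _ => ConvexOn.quasiconvexOn ⟨convex_stdSimplex ℝ G, fun w _ w' _ s t _ _ _ => by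
      refine le_of_eq ?_
      simp only [f, smul_eq_mul, Finset.mul_sum (s := (Finset.univ : Finset G)),
        ← Finset.sum_add_distrib]
      refine Finset.sum_congr rfl fun p _ => ?_
      simp only [Pi.add_apply, Pi.smul_apply, smul_eq_mul]
      ring⟩)
    (convex_Icc _ _) ⟨0, le_rfl, zero_le_one⟩ isCompact_Icc
    (fun w _ => (Continuous.upperSemicontinuous (by fun_prop)).upperSemicontinuousOn _)
    (fun w _ => ConcaveOn.quasiconcaveOn ⟨convex_Icc _ _, fun y _ y' _ s t _ _ hst => by
      refine le_of_eq ?_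
      obtain rfl : t = 1 - s := by linarith
      simp only [f, smul_eq_mul, Finset.mul_sum, ← Finset.sum_add_distrib]
      refine Finset.sum_congr rfl fun p _ => Finset.sum_congr rfl fun k _ => ?_
      simp only [Pi.add_apply, Pi.smul_apply, smul_eq_mul]
      ring⟩)
  -- Against the fixed outcome `y₀` the predictor may respond with a net point within `ε` of it.
  -- Each coordinate of the bias is then at most `ε`, and the coefficients have total size at most
  -- one.
  have hval : f w y₀ ≤ ε := by
    obtain ⟨p, hp⟩ := hnet ⟨y₀, hy₀⟩
    refine (hsaddle _ (single_mem_stdSimplex ℝ p) y₀ hy₀).trans ?_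
    simp only [f, Pi.single_apply, ite_mul, one_mul, zero_mul, Finset.sum_ite_eq',
      Finset.mem_univ, if_true]
    calc ∑ k, a k p * (((p : Cube d) : Fin d → ℝ) (i k) - y₀ (i k))
        ≤ ∑ k, |a k p| * ε := Finset.sum_le_sum fun k _ => by
          refine (le_abs_self _).trans ?_
          rw [abs_mul]
          gcongr
          have h1 := norm_le_pi_norm (((p : Cube d) : Fin d → ℝ) - y₀) (i k)
          have h2 : ‖((p : Cube d) : Fin d → ℝ) - y₀‖ < ε := by
            rw [← dist_eq_norm, dist_comm]; exact hp
          exact h1.trans h2.le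
      _ ≤ ε := by
          rw [← Finset.sum_mul]
          exact mul_le_of_le_one_left hε.le (ha _)
  let ν : Measure (Cube d) := ∑ p : G, ENNReal.ofReal (w p) • Measure.dirac (p : Cube d)
  have hint : ∀ g : Cube d → ℝ, ∫ p, g p ∂ν = ∑ p : G, w p * g p := by
    intro g
    rw [integral_finsetSum_measure fun p _ => (integrable_dirac (by simp)).smul_measure (by simp)]
    refine Finset.sum_congr rfl fun p _ => ?_
    rw [integral_smul_measure, integral_dirac, ENNReal.toReal_ofReal (hw.1 p), smul_eq_mul]
  refine ⟨ν, ⟨?_⟩, fun y => ?_⟩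
  · simp only [ν, Measure.coe_finsetSum, Finset.sum_apply, Measure.smul_apply, measure_univ,
      smul_eq_mul, mul_one]
    rw [← ENNReal.ofReal_sum_of_nonneg fun p _ => hw.1 p, hw.2, ENNReal.ofReal_one]
  · calc _ = f w y := by
          simp_rw [hint, f, Finset.mul_sum]
          exact Finset.sum_comm
      _ ≤ f w y₀ := hsaddle w hw y y.2
      _ ≤ ε := hval

end Minmax

/-! ### Size and measurability of gains and weights. -/

section Gain

variable {κ : Type uK} {𝒳 : Type uX} {d : ℕ} {E : EventFamily κ 𝒳 d}

/-- The bound `c` is kept general so that it can be `0` in rounds outside the subsequence; this is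
what makes the cumulative squared bias at most `|S|`. -/
lemma abs_gain_le (ν : Measure (Cube d)) [IsProbabilityMeasure ν] {t : ℕ}
    {h : Transcript 𝒳 d t} {x : 𝒳} (y : Cube d) {k : Expert κ d} {c : ℝ}
    (hE : ∀ p, |E k.1 t h x p| ≤ c) : |gain E ν t h x y k| ≤ c := by
  unfold gain
  have h1 : |if k.2.2 then (1 : ℝ) else -1| = 1 := by split_ifs <;> simp
  rw [abs_mul, h1, one_mul]
  rw [← Real.norm_eq_abs]
  refine le_of_le_of_eq (norm_integral_le_of_norm_le_const (C := c)
    (Filter.Eventually.of_forall fun p => ?_)) (by rw [probReal_univ, mul_one])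
  rw [Real.norm_eq_abs, abs_mul]
  calc _ ≤ c * 1 := by
        gcongr
        · exact (abs_nonneg _).trans (hE p)
        · exact hE p
        · exact Cube.abs_sub_le_one p y _
    _ = c := mul_one c

variable [MeasurableSpace 𝒳]

/-- The events are jointly measurable in transcript, feature and prediction. -/
def EventFamily.IsMeasurable (E : EventFamily κ 𝒳 d) : Prop :=
  ∀ e t, Measurable fun z : (Transcript 𝒳 d t × 𝒳) × Cube d => E e t z.1.1 z.1.2 z.2

lemma EventFamily.IsMeasurable.measurable_gain (hE : E.IsMeasurable) (ψ : Forecaster 𝒳 d) (t : ℕ)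
    [IsMarkovKernel (ψ t)] (k : Expert κ d) :
    Measurable fun z : (Transcript 𝒳 d t × 𝒳) × Cube d =>
      gain E (ψ t z.1) t z.1.1 z.1.2 z.2 k := by
  unfold gain
  refine Measurable.const_mul ?_ _
  have hm : Measurable fun w : ((Transcript 𝒳 d t × 𝒳) × Cube d) × Cube d =>
      E k.1 t w.1.1.1 w.1.1.2 w.2 *
        ((w.2 : Fin d → ℝ) k.2.1 - (w.1.2 : Fin d → ℝ) k.2.1) := by
    refine ((hE k.1 t).comp (Measurable.prodMk (measurable_fst.comp measurable_fst)
      measurable_snd)).mul (Measurable.sub ?_ ?_)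
    · exact (measurable_pi_apply _).comp (measurable_subtype_coe.comp measurable_snd)
    · exact (measurable_pi_apply _).comp
        (measurable_subtype_coe.comp (measurable_snd.comp measurable_fst))
  exact (hm.stronglyMeasurable.integral_kernel_prod_right'
    (κ := (ψ t).comap Prod.fst measurable_fst)).measurable

variable [Fintype κ]

lemma EventFamily.IsMeasurable.measurable_expertWeight (hE : E.IsMeasurable) (ψ : Forecaster 𝒳 d)
    (hψ : ∀ t, IsMarkovKernel (ψ t)) {W : ℝ → ℝ → ℝ} (hW : Measurable (Function.uncurry W))
    (t : ℕ) (k : Expert κ d) :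
    Measurable fun h : Transcript 𝒳 d t => expertWeight E ψ W h k := by
  have hg : ∀ k s, Measurable fun h : Transcript 𝒳 d t => pastGain E ψ h k s := fun k s => by
    have := hψ s
    have hs : Measurable fun h : Transcript 𝒳 d t => h s := measurable_pi_apply _
    exact (hE.measurable_gain ψ s k).comp (Measurable.prodMk (Measurable.prodMk
      (measurable_pi_lambda _ fun r => measurable_pi_apply _) hs.fst) hs.snd.snd)
  have hWk : ∀ k, Measurable fun h : Transcript 𝒳 d t =>
      W (∑ s, pastGain E ψ h k s) (∑ s, pastGain E ψ h k s ^ 2) := fun k =>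
    hW.comp (Measurable.prodMk (Finset.measurable_sum Finset.univ fun s _ => hg k s)
      (Finset.measurable_sum Finset.univ fun s _ => (hg k s).pow_const 2))
  exact (hWk k).div (Finset.measurable_sum _ fun k' _ => hWk k')

/-- Only earlier rounds of the forecaster influence the current weights, so a forecaster can be
built round by round. -/
lemma expertWeight_congr {ψ ψ' : Forecaster 𝒳 d} {W : ℝ → ℝ → ℝ} {t : ℕ}
    (h : ∀ s < t, ψ s = ψ' s) (g : Transcript 𝒳 d t) (k : Expert κ d) :
    expertWeight E ψ W g k = expertWeight E ψ' W g k := by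
  have : ∀ k s, pastGain E ψ g k s = pastGain E ψ' g k s := fun k s => by
    unfold pastGain; rw [h s s.isLt]
  simp_rw [expertWeight, this]

end Gain

/-! ### Measurable selection of near-optimal forecasters. -/

section Existence

lemma exists_kernel_of_countable {α C β : Type*} [MeasurableSpace α] [MeasurableSpace β]
    [Countable C] (g : α → C) (hg : ∀ c, MeasurableSet (g ⁻¹' {c})) (f : C → Measure β)
    (hf : ∀ c, IsProbabilityMeasure (f c)) :
    ∃ η : Kernel α β, IsMarkovKernel η ∧ ∀ a, η a = f (g a) := by
  let _ : MeasurableSpace C := ⊤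
  have hg' : Measurable g := measurable_to_countable' hg
  exact ⟨(Kernel.ofFunOfCountable f).comap g hg', ⟨fun a => hf (g a)⟩, fun a => rfl⟩

lemma exists_near_min {α : Type*} (Q : α → Prop) (hQ : ∃ a, Q a) (f : α → ℝ) (c : ℝ)
    (hc : ∀ a, Q a → c ≤ f a) {ε : ℝ} (hε : 0 < ε) : ∃ a, Q a ∧ ∀ b, Q b → f a ≤ f b + ε := by
  obtain ⟨a₀, ha₀⟩ := hQ
  have hbdd : BddBelow (f '' {a | Q a}) := ⟨c, by rintro _ ⟨a, ha, rfl⟩; exact hc a ha⟩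
  obtain ⟨_, ⟨a, ha, rfl⟩, hlt⟩ := exists_lt_of_csInf_lt (s := f '' {a | Q a})
    ⟨_, a₀, ha₀, rfl⟩ (lt_add_of_pos_right _ hε)
  exact ⟨a, ha, fun b hb => by linarith [csInf_le hbdd ⟨b, hb, rfl⟩]⟩

lemma ciSup_le_ciSup_add {α : Type*} [Nonempty α] {f g : α → ℝ} {c : ℝ}
    (hg : BddAbove (Set.range g)) (h : ∀ a, f a ≤ g a + c) : ⨆ a, f a ≤ (⨆ a, g a) + c :=
  ciSup_le fun a => (h a).trans (by gcongr; exact le_ciSup hg a)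

variable {κ : Type uK} [Fintype κ] {𝒳 : Type uX} {d : ℕ} {E : EventFamily κ 𝒳 d}

/-- The largest weighted bias, over all outcomes, of the prediction distribution `ν` for the
weights `q`. -/
def worstBias (E : EventFamily κ 𝒳 d) (q : Expert κ d → ℝ) (t : ℕ) (h : Transcript 𝒳 d t) (x : 𝒳)
    (ν : Measure (Cube d)) : ℝ :=
  ⨆ y, ∑ k, q k * gain E ν t h x y k

lemma abs_sum_mul_gain_le (hE : ∀ e t h x p, |E e t h x p| ≤ 1) (q : Expert κ d → ℝ) {t : ℕ}
    (h : Transcript 𝒳 d t) (x : 𝒳) (ν : Measure (Cube d)) [IsProbabilityMeasure ν] (y : Cube d) :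
    |∑ k, q k * gain E ν t h x y k| ≤ ∑ k, |q k| := by
  refine (Finset.abs_sum_le_sum_abs _ _).trans (Finset.sum_le_sum fun k _ => ?_)
  rw [abs_mul]
  exact mul_le_of_le_one_right (abs_nonneg _) (abs_gain_le ν y (hE k.1 t h x))

lemma bddAbove_sum_mul_gain (hE : ∀ e t h x p, |E e t h x p| ≤ 1) (q : Expert κ d → ℝ) {t : ℕ}
    (h : Transcript 𝒳 d t) (x : 𝒳) (ν : Measure (Cube d)) [IsProbabilityMeasure ν] :
    BddAbove (Set.range fun y => ∑ k, q k * gain E ν t h x y k) :=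
  ⟨∑ k, |q k|, by rintro _ ⟨y, rfl⟩; exact (abs_le.1 (abs_sum_mul_gain_le hE q h x ν y)).2⟩

/-- Gains are at most one in absolute value, so the worst bias is `1`-Lipschitz in the weights for
the `ℓ¹` norm, uniformly in `ν`. This justifies rounding the weights. -/
lemma worstBias_le_add (hE : ∀ e t h x p, |E e t h x p| ≤ 1) (q q' : Expert κ d → ℝ) {t : ℕ}
    (h : Transcript 𝒳 d t) (x : 𝒳) (ν : Measure (Cube d)) [IsProbabilityMeasure ν] {c : ℝ}
    (hc : ∑ k, |q k - q' k| ≤ c) : worstBias E q t h x ν ≤ worstBias E q' t h x ν + c := by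
  refine ciSup_le_ciSup_add (bddAbove_sum_mul_gain hE q' h x ν) fun y => ?_
  have h1 := (abs_le.1 (abs_sum_mul_gain_le hE (fun k => q k - q' k) h x ν y)).2
  simp only [sub_mul, Finset.sum_sub_distrib] at h1
  linarith

lemma neg_sum_le_worstBias (hE : ∀ e t h x p, |E e t h x p| ≤ 1) (q : Expert κ d → ℝ) {t : ℕ}
    (h : Transcript 𝒳 d t) (x : 𝒳) (ν : Measure (Cube d)) [IsProbabilityMeasure ν] :
    -∑ k, |q k| ≤ worstBias E q t h x ν :=
  (abs_le.1 (abs_sum_mul_gain_le hE q h x ν ⟨0, le_rfl, zero_le_one⟩)).1.trans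
    (le_ciSup (bddAbove_sum_mul_gain hE q h x ν) _)

/-- If the events depend on the past only through a countable code, then near-optimal prediction
distributions can be chosen measurably. -/
lemma exists_kernel_worstBias_le [MeasurableSpace 𝒳] {Z : Type*} [Countable Z]
    (hE : ∀ e t h x p, |E e t h x p| ≤ 1) {t : ℕ} (code : Transcript 𝒳 d t × 𝒳 → Z)
    (hcode : ∀ z, MeasurableSet (code ⁻¹' {z}))
    (hEcode : ∀ h x h' x', code (h, x) = code (h', x') → ∀ e p, E e t h x p = E e t h' x' p)
    (q : Transcript 𝒳 d t × 𝒳 → Expert κ d → ℝ) (hq : ∀ k, Measurable fun z => q z k)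
    {ε : ℝ} (hε : 0 < ε) :
    ∃ η : Kernel (Transcript 𝒳 d t × 𝒳) (Cube d), IsMarkovKernel η ∧
      ∀ h x (ν : Measure (Cube d)), IsProbabilityMeasure ν →
        worstBias E (q (h, x)) t h x (η (h, x)) ≤ worstBias E (q (h, x)) t h x ν + ε := by
  classical
  -- Rounding all weights to multiples of `1 / M` costs at most `ε / 4`, and it is paid twice, for
  -- the chosen distribution and for its competitor. The other `ε / 2` is the tolerance of the
  -- near-minimizer of the rounded problem.
  obtain ⟨M, hM⟩ := exists_nat_gt (4 * (Fintype.card (Expert κ d) : ℝ) / ε)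
  have hM0 : (0 : ℝ) < M := lt_of_le_of_lt (by positivity) hM
  have hMK : (Fintype.card (Expert κ d) : ℝ) * (1 / M) ≤ ε / 4 := by
    rw [div_lt_iff₀ hε] at hM
    rw [mul_one_div, div_le_iff₀ hM0]
    linarith
  let round : (Expert κ d → ℤ) → Expert κ d → ℝ := fun v k => v k / M
  have hex : ∀ c : Z × (Expert κ d → ℤ), ∃ ν : Measure (Cube d), IsProbabilityMeasure ν ∧
      ∀ h x, code (h, x) = c.1 → ∀ ν', IsProbabilityMeasure ν' →
        worstBias E (round c.2) t h x ν ≤ worstBias E (round c.2) t h x ν' + ε / 2 := by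
    rintro ⟨z, v⟩
    by_cases hz : ∃ h x, code (h, x) = z
    · obtain ⟨h, x, hz⟩ := hz
      obtain ⟨ν, hν, hmin⟩ := exists_near_min
        (fun ν : Measure (Cube d) => IsProbabilityMeasure ν)
        ⟨Measure.dirac ⟨0, le_rfl, zero_le_one⟩, inferInstance⟩
        (fun ν => worstBias E (round v) t h x ν) _
        (fun ν hν => neg_sum_le_worstBias hE (round v) h x ν) (half_pos hε)
      refine ⟨ν, hν, fun h' x' hz' ν' hν' => ?_⟩
      -- With rounded weights fixed, histories with equal codes pose the same problem, so one choice
      -- serves them all.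
      have heq : ∀ ν, worstBias E (round v) t h' x' ν = worstBias E (round v) t h x ν := by
        intro ν
        unfold worstBias gain
        simp_rw [hEcode h' x' h x (hz'.trans hz.symm)]
      rw [heq, heq]
      exact hmin ν' hν'
    · exact ⟨Measure.dirac ⟨0, le_rfl, zero_le_one⟩, inferInstance,
        fun h x hc => absurd ⟨h, x, hc⟩ hz⟩
  choose f hf hfmin using hex
  let g : Transcript 𝒳 d t × 𝒳 → Z × (Expert κ d → ℤ) := fun z => (code z, fun k => ⌊M * q z k⌋)
  have hg : ∀ c, MeasurableSet (g ⁻¹' {c}) := by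
    rintro ⟨z, v⟩
    have : g ⁻¹' {(z, v)} = code ⁻¹' {z} ∩ ⋂ k, (fun w => ⌊M * q w k⌋) ⁻¹' {v k} := by
      ext w; simp [g, funext_iff]
    rw [this]
    exact (hcode z).inter (MeasurableSet.iInter fun k =>
      (Int.measurable_floor.comp ((hq k).const_mul _)) (MeasurableSet.singleton _))
  obtain ⟨η, hη, hηf⟩ := exists_kernel_of_countable g hg f hf
  refine ⟨η, hη, fun h x ν hν => ?_⟩
  have hround : ∀ k, |q (h, x) k - round (g (h, x)).2 k| ≤ 1 / M := fun k => by
    have h1 := Int.floor_le (M * q (h, x) k)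
    have h2 := Int.lt_floor_add_one (M * q (h, x) k)
    have h3 : q (h, x) k - round (g (h, x)).2 k =
        (M * q (h, x) k - ⌊M * q (h, x) k⌋) * (1 / M) := by
      simp only [round, g]; field_simp
    rw [h3, abs_mul, abs_of_pos (one_div_pos.2 hM0), abs_of_nonneg (by linarith)]
    exact mul_le_of_le_one_left (by positivity) (by linarith)
  have hsum : ∑ k, |q (h, x) k - round (g (h, x)).2 k| ≤ ε / 4 := by
    refine le_trans ?_ hMK
    calc _ ≤ ∑ _k : Expert κ d, 1 / (M : ℝ) := Finset.sum_le_sum fun k _ => hround k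
      _ = _ := by rw [Finset.sum_const, Finset.card_univ, nsmul_eq_mul]
  have hsum' : ∑ k, |round (g (h, x)).2 k - q (h, x) k| ≤ ε / 4 := by
    simpa only [abs_sub_comm] using hsum
  rw [hηf]
  have := hf (g (h, x))
  have h1 := worstBias_le_add hE _ _ h x (f (g (h, x))) hsum
  have h2 := hfmin (g (h, x)) h x rfl ν hν
  have h3 := worstBias_le_add hE _ _ h x ν hsum'
  linarith

lemma exists_isUnbiasedPrediction [MeasurableSpace 𝒳] {Z : Type*} [Countable Z]
    (hE : ∀ e t h x p, |E e t h x p| ≤ 1) (hEm : E.IsMeasurable)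
    (code : ∀ t, Transcript 𝒳 d t × 𝒳 → Z) (hcode : ∀ t z, MeasurableSet (code t ⁻¹' {z}))
    (hEcode : ∀ t h x h' x', code t (h, x) = code t (h', x') →
      ∀ e p, E e t h x p = E e t h' x' p)
    {W : ℝ → ℝ → ℝ} (hW : Measurable (Function.uncurry W)) {ε : ℝ} (hε : 0 < ε) (T : ℕ) :
    ∃ ψ : Forecaster 𝒳 d, IsUnbiasedPrediction E ψ W ε T := by
  have hnext : ∀ (ψ : {ψ : Forecaster 𝒳 d // ∀ t, IsMarkovKernel (ψ t)}) (t : ℕ),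
      ∃ η : Kernel (Transcript 𝒳 d t × 𝒳) (Cube d), IsMarkovKernel η ∧
        ∀ h x (ν : Measure (Cube d)), IsProbabilityMeasure ν →
          worstBias E (fun k => expertWeight E ψ.1 W h k) t h x (η (h, x)) ≤
            worstBias E (fun k => expertWeight E ψ.1 W h k) t h x ν + ε := fun ψ t =>
    exists_kernel_worstBias_le hE (code t) (hcode t) (hEcode t)
      (fun z k => expertWeight E ψ.1 W z.1 k)
      (fun k => (hEm.measurable_expertWeight ψ.1 ψ.2 hW t k).comp measurable_fst) hε
  choose next hnextM hnextmin using hnext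
  let ψ₀ : {ψ : Forecaster 𝒳 d // ∀ t, IsMarkovKernel (ψ t)} :=
    ⟨fun t => Kernel.const _ (Measure.dirac ⟨0, le_rfl, zero_le_one⟩), fun t => inferInstance⟩
  -- `Ψ m` has its final values in the rounds before `m`; step `m` overwrites round `m` by a
  -- near-optimal kernel for the weights produced by `Ψ m`. The desired forecaster is the diagonal.
  let Ψ : ℕ → {ψ : Forecaster 𝒳 d // ∀ t, IsMarkovKernel (ψ t)} := fun m =>
    Nat.rec ψ₀ (fun m ψ => ⟨Function.update ψ.1 m (next ψ m), fun t => by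
      by_cases h : t = m
      · subst h; rw [Function.update_self]; exact hnextM ψ t
      · rw [Function.update_of_ne h]; exact ψ.2 t⟩) m
  have hsucc : ∀ m, (Ψ (m + 1)).1 = Function.update (Ψ m).1 m (next (Ψ m) m) := fun m => rfl
  have hstable : ∀ m n, m ≤ n → ∀ s < m, (Ψ n).1 s = (Ψ m).1 s := by
    intro m n hmn
    induction n, hmn using Nat.le_induction with
    | base => exact fun s _ => rfl
    | succ n hmn ih =>
      intro s hs
      rw [hsucc, Function.update_of_ne (by omega), ih s hs]
  let ψ : Forecaster 𝒳 d := fun t => (Ψ (t + 1)).1 t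
  have hψ : ∀ t, ψ t = next (Ψ t) t := fun t => by
    change (Ψ (t + 1)).1 t = _
    rw [hsucc, Function.update_self]
  refine ⟨ψ, fun t => (Ψ (t + 1)).2 t, fun t _ h x ν hν => ?_⟩
  have hw : ∀ k, expertWeight E ψ W h k = expertWeight E (Ψ t).1 W h k :=
    expertWeight_congr (fun s hs => (hstable (s + 1) t hs s (Nat.lt_succ_self s)).symm) h
  have := hnextmin (Ψ t) t h x ν hν
  unfold objective
  simp_rw [hw]
  rw [hψ]
  exact this

end Existence

/-! ### Existence of Decision-Calibration-Subsequence. -/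

section SetupExistence

variable {𝒳 : Type uX} [MeasurableSpace 𝒳] {𝒜 : Type uA} [Fintype 𝒜] {𝒩 : Type uN} [Fintype 𝒩]
  {d J I : ℕ} {L : ℝ} (P : Setup 𝒳 𝒜 𝒩 d J I L)

lemma Setup.abs_events_le (e : 𝒩 × 𝒜 × Fin I) (t : ℕ) (h : Transcript 𝒳 d t) (x : 𝒳) (p : Cube d) :
    |P.events e t h x p| ≤ open Classical in if x ∈ P.sub e.2.2 t then 1 else 0 := by
  classical
  unfold Setup.events
  by_cases h1 : x ∈ P.sub e.2.2 t <;> by_cases h2 : P.action e.1 t h x p = e.2.1 <;> simp [h1, h2]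

lemma Setup.abs_events_le_one (e : 𝒩 × 𝒜 × Fin I) (t : ℕ) (h : Transcript 𝒳 d t) (x : 𝒳)
    (p : Cube d) : |P.events e t h x p| ≤ 1 :=
  (P.abs_events_le e t h x p).trans (by split_ifs <;> simp)

lemma measurable_multiscaleWeight (T : ℕ) : Measurable (Function.uncurry (multiscaleWeight T)) := by
  unfold multiscaleWeight Function.uncurry
  fun_prop

/-- The code consists of the candidate sets of all agents and the set of active subsequences: it
takes finitely many values, and it determines the events as functions of the prediction. -/
lemma Setup.exists_isDecisionCalibrationSubsequence :
    ∃ ψ : Forecaster 𝒳 d, P.IsDecisionCalibrationSubsequence ψ := by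
  classical
  -- For `T = 0` the tolerance `1 / T` reads as `0`, which is not positive, but there are no rounds
  -- to satisfy.
  rcases Nat.eq_zero_or_pos P.T with hT | hT
  · refine ⟨fun t => Kernel.const _ (Measure.dirac ⟨0, le_rfl, zero_le_one⟩),
      fun t => inferInstance, fun t ht => ?_⟩
    omega
  refine exists_isUnbiasedPrediction (Z := (𝒩 → Finset 𝒜) × Set (Fin I)) P.abs_events_le_one
    P.measurable_events (fun t z => (fun n => P.union n t z.1 z.2, {i | z.2 ∈ P.sub i t}))
    ?_ ?_ (measurable_multiscaleWeight P.T) (by positivity) P.T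
  · rintro t ⟨U, A⟩
    have : (fun z : Transcript 𝒳 d t × 𝒳 =>
        ((fun n => P.union n t z.1 z.2, {i | z.2 ∈ P.sub i t}) : (𝒩 → Finset 𝒜) × Set (Fin I))) ⁻¹'
          {(U, A)} = (⋂ n, {z | P.union n t z.1 z.2 = U n}) ∩
            ⋂ i, {z | z.2 ∈ P.sub i t ↔ i ∈ A} := by
      ext z; simp [funext_iff, Set.ext_iff]
    rw [this]
    refine (MeasurableSet.iInter fun n => P.measurableSet_union_eq n t (U n)).inter
      (MeasurableSet.iInter fun i => ?_)
    have hi : MeasurableSet {z : Transcript 𝒳 d t × 𝒳 | z.2 ∈ P.sub i t} :=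
      measurable_snd (P.sub_measurable i t)
    by_cases hA : i ∈ A
    · simpa only [hA, iff_true] using hi
    · have : {z : Transcript 𝒳 d t × 𝒳 | z.2 ∈ P.sub i t ↔ i ∈ A} =
          {z : Transcript 𝒳 d t × 𝒳 | z.2 ∈ P.sub i t}ᶜ := by
        ext z; simp [hA]
      rw [this]
      exact hi.compl
  · intro t h x h' x' hc e p
    have h1 : P.union e.1 t h x = P.union e.1 t h' x' := congrFun (congrArg Prod.fst hc) e.1
    have h2 : x ∈ P.sub e.2.2 t ↔ x' ∈ P.sub e.2.2 t :=
      Set.ext_iff.1 (congrArg Prod.snd hc) e.2.2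
    simp only [Setup.events, Setup.action, h1]
    exact if_congr (and_congr_left' h2) rfl rfl

end SetupExistence

/-! ### The potential of second-order exponential weights. -/

section Potential

/-- The squared correction in the exponent makes the growth of each potential term at most linear in
the gain. The claim is rewritten as `1 ≤ (1 + x) exp(x² - x)`. -/
lemma exp_sub_sq_le {x : ℝ} (hx : |x| ≤ 1 / 2) : Real.exp (x - x ^ 2) ≤ 1 + x := by
  obtain ⟨h1, h2⟩ := abs_le.1 hx
  have h3 : x - x ^ 2 = -(x ^ 2 - x) := by ring
  rw [h3, Real.exp_neg]
  refine inv_le_of_inv_le₀ (by linarith) ?_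
  rw [inv_le_iff_one_le_mul₀ (by linarith)]
  rcases le_total 0 x with h0 | h0
  -- First order suffices here: `(1 + x)(1 - x + x²) = 1 + x³`.
  · have := Real.add_one_le_exp (x ^ 2 - x)
    calc (1 : ℝ) ≤ (1 + x) * (x ^ 2 - x + 1) := by nlinarith [pow_nonneg h0 3]
      _ ≤ _ := by rw [mul_comm]; gcongr
  · have := Real.quadratic_le_exp_of_nonneg (x := x ^ 2 - x) (by nlinarith)
    -- With the quadratic Taylor bound, the product exceeds `1` by `x² / 2` times this polynomial.
    have hpoly : 0 ≤ 1 + x - x ^ 2 + x ^ 3 := by nlinarith [sq_nonneg x]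
    calc (1 : ℝ) ≤ (1 + x) * (1 + (x ^ 2 - x) + (x ^ 2 - x) ^ 2 / 2) := by
          nlinarith [mul_nonneg (sq_nonneg x) hpoly]
      _ ≤ _ := by rw [mul_comm]; gcongr; linarith

lemma multiscaleWeight_pos (T : ℕ) (G V : ℝ) : 0 < multiscaleWeight T G V :=
  Finset.sum_pos (fun m _ => by positivity) ⟨0, by simp⟩

/-- Regret bound of second-order exponential weights with a mixture of learning rates, when the
weighted gains are at most `1 / T` in every round. -/
lemma mul_sum_sub_sq_mul_sum_sq_le {K : Type*} [Fintype K] (g : ℕ → K → ℝ) {T : ℕ} (hT : 0 < T)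
    (hg : ∀ t < T, ∀ k, |g t k| ≤ 1)
    (hmin : ∀ t < T, ∑ k, multiscaleWeight T (∑ s ∈ Finset.range t, g s k)
        (∑ s ∈ Finset.range t, g s k ^ 2) * g t k ≤
      1 / T * ∑ k, multiscaleWeight T (∑ s ∈ Finset.range t, g s k)
        (∑ s ∈ Finset.range t, g s k ^ 2))
    (k : K) {m : ℕ} (hm : m < Nat.log 2 T + 1) :
    (2⁻¹ : ℝ) ^ (m + 1) * ∑ s ∈ Finset.range T, g s k -
        ((2⁻¹ : ℝ) ^ (m + 1)) ^ 2 * ∑ s ∈ Finset.range T, g s k ^ 2 ≤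
      Real.log (2 * (Fintype.card K * (Nat.log 2 T + 1))) := by
  set η : ℕ → ℝ := fun m => (2⁻¹ : ℝ) ^ (m + 1) with hη
  set M := Finset.range (Nat.log 2 T + 1) with hM
  have hη0 : ∀ m, 0 ≤ η m := fun m => by positivity
  have hη2 : ∀ m, η m ≤ 1 / 2 := fun m => by
    simp only [hη, pow_succ]
    have : (2⁻¹ : ℝ) ^ m ≤ 1 := pow_le_one₀ (by norm_num) (by norm_num)
    linarith
  set e : ℕ → K → ℕ → ℝ := fun t k m => Real.exp (η m * ∑ s ∈ Finset.range t, g s k -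
      η m ^ 2 * ∑ s ∈ Finset.range t, g s k ^ 2) with he
  -- The potential omits the factor `η` of the weights: `η e` is exactly the coefficient of the gain
  -- in the linear bound for the increment of `Φ`, so `hmin` controls that increment.
  set Φ : ℕ → ℝ := fun t => ∑ k, ∑ m ∈ M, e t k m with hΦ
  have he0 : ∀ t k m, 0 ≤ e t k m := fun t k m => Real.exp_nonneg _
  have hΦ0 : ∀ t, 0 ≤ Φ t := fun t =>
    Finset.sum_nonneg fun k _ => Finset.sum_nonneg fun m _ => he0 t k m
  have hW : ∀ t k, multiscaleWeight T (∑ s ∈ Finset.range t, g s k)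
      (∑ s ∈ Finset.range t, g s k ^ 2) = ∑ m ∈ M, η m * e t k m := fun t k => rfl
  have hstep : ∀ t < T, Φ (t + 1) ≤ Φ t * (1 + 1 / (2 * T)) := by
    intro t ht
    have h1 : Φ (t + 1) ≤ ∑ k, ∑ m ∈ M, e t k m * (1 + η m * g t k) := by
      refine Finset.sum_le_sum fun k _ => Finset.sum_le_sum fun m _ => ?_
      have h2 : e (t + 1) k m = e t k m * Real.exp (η m * g t k - (η m * g t k) ^ 2) := by
        simp only [he]
        rw [← Real.exp_add, Finset.sum_range_succ, Finset.sum_range_succ]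
        ring_nf
      rw [h2]
      refine mul_le_mul_of_nonneg_left (exp_sub_sq_le ?_) (he0 t k m)
      rw [abs_mul, abs_of_nonneg (hη0 m)]
      calc η m * |g t k| ≤ 1 / 2 * 1 := by
            gcongr
            · exact hη2 m
            · exact hg t ht k
        _ = 1 / 2 := by norm_num
    have h3 : ∑ k, ∑ m ∈ M, e t k m * (1 + η m * g t k) =
        Φ t + ∑ k, (∑ m ∈ M, η m * e t k m) * g t k := by
      rw [hΦ, ← Finset.sum_add_distrib]
      refine Finset.sum_congr rfl fun k _ => ?_
      rw [Finset.sum_mul, ← Finset.sum_add_distrib]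
      exact Finset.sum_congr rfl fun m _ => by ring
    have h4 := hmin t ht
    simp_rw [hW] at h4
    -- All rates are at most `1 / 2`, which gives the growth factor `1 + 1 / (2T)` per round and at
    -- most `exp(1 / 2) ≤ 2` overall.
    have h5 : ∑ k, ∑ m ∈ M, η m * e t k m ≤ 1 / 2 * Φ t := by
      rw [hΦ, Finset.mul_sum]
      refine Finset.sum_le_sum fun k _ => ?_
      rw [Finset.mul_sum]
      exact Finset.sum_le_sum fun m _ => mul_le_mul_of_nonneg_right (hη2 m) (he0 t k m)
    calc Φ (t + 1) ≤ Φ t + 1 / T * (1 / 2 * Φ t) := by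
          rw [h3] at h1
          refine h1.trans ?_
          gcongr
          exact h4.trans (by gcongr)
      _ = Φ t * (1 + 1 / (2 * T)) := by ring
  have hiter : ∀ t ≤ T, Φ t ≤ Φ 0 * (1 + 1 / (2 * T)) ^ t := by
    intro t
    induction t with
    | zero => intro _; simp
    | succ t ih =>
      intro ht
      calc Φ (t + 1) ≤ Φ t * (1 + 1 / (2 * T)) := hstep t ht
        _ ≤ Φ 0 * (1 + 1 / (2 * T)) ^ t * (1 + 1 / (2 * T)) := by gcongr; exact ih (by omega)
        _ = _ := by ring
  have hT' : (0 : ℝ) < T := by exact_mod_cast hT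
  have hpow : (1 + 1 / (2 * T) : ℝ) ^ T ≤ 2 := by
    calc (1 + 1 / (2 * T) : ℝ) ^ T ≤ Real.exp (1 / (2 * T)) ^ T := by
          gcongr
          have := Real.add_one_le_exp (1 / (2 * (T : ℝ)))
          linarith
      _ = Real.exp (1 / 2) := by
          rw [← Real.exp_nat_mul]
          congr 1
          field_simp
      _ ≤ 2 := by
          refine le_of_sq_le_sq ?_ (by norm_num)
          rw [← Real.exp_nat_mul]
          have := Real.exp_one_lt_d9
          norm_num
          linarith
  have hinit : Φ 0 = Fintype.card K * (Nat.log 2 T + 1) := by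
    simp [hΦ, he, hM]
    ring
  have hterm : e T k m ≤ Φ T :=
    (Finset.single_le_sum (f := fun m => e T k m) (fun m _ => he0 T k m)
      (Finset.mem_range.2 hm)).trans
      (Finset.single_le_sum (f := fun k => ∑ m ∈ M, e T k m)
        (fun k _ => Finset.sum_nonneg fun m _ => he0 T k m) (Finset.mem_univ k))
  refine (Real.le_log_iff_exp_le (lt_of_lt_of_le (Real.exp_pos _) (hterm.trans ?_))).2
    (hterm.trans ?_)
  all_goals
    rw [← hinit, mul_comm]
    exact (hiter T le_rfl).trans (by gcongr)

end Potential

/-! ### Bias of an unbiased-prediction forecaster along a path. -/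

section UnbiasedPath

variable {κ : Type uK} [Fintype κ] {𝒳 : Type uX} [MeasurableSpace 𝒳] {d : ℕ}
  {E : EventFamily κ 𝒳 d} {ψ : Forecaster 𝒳 d}

/-- The weights are nonnegative with sum at most one, so for every `ε' > 0` some distribution has
worst bias at most `ε'`. Near-optimality then leaves only the tolerance `ε`. -/
lemma objective_le_of_isUnbiasedPrediction (hE : ∀ e t h x p, |E e t h x p| ≤ 1)
    {W : ℝ → ℝ → ℝ} (hW : ∀ G V, 0 < W G V) {ε : ℝ} {T : ℕ} (hψ : IsUnbiasedPrediction E ψ W ε T)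
    {t : ℕ} (ht : t < T) (h : Transcript 𝒳 d t) (x : 𝒳) (y : Cube d) :
    objective E ψ W t h x (ψ t (h, x)) y ≤ ε := by
  have := hψ.1 t
  refine (le_ciSup (bddAbove_sum_mul_gain hE (fun k => expertWeight E ψ W h k) h x (ψ t (h, x)))
    y).trans ?_
  refine le_of_forall_pos_le_add fun ε' hε' => ?_
  set q : Expert κ d → ℝ := fun k => expertWeight E ψ W h k with hq
  set Wk : Expert κ d → ℝ := fun k => W (∑ s, pastGain E ψ h k s) (∑ s, pastGain E ψ h k s ^ 2)
  have hW0 : 0 ≤ ∑ k, Wk k := Finset.sum_nonneg fun k _ => (hW _ _).le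
  have hq0 : ∀ k, 0 ≤ q k := fun k => div_nonneg (hW _ _).le hW0
  have hq1 : ∑ k, q k ≤ 1 := by
    change ∑ k, Wk k / ∑ k', Wk k' ≤ 1
    rw [← Finset.sum_div]
    exact div_self_le_one _
  obtain ⟨ν, hν, hbias⟩ := exists_distribution_bias_le
    (fun (k : Expert κ d) p => q k * ((if k.2.2 then 1 else -1) * E k.1 t h x p))
    (fun k => k.2.1) (fun p => by
      refine (Finset.sum_le_sum fun k _ => ?_).trans hq1
      rw [abs_mul, abs_mul, abs_of_nonneg (hq0 k)]
      refine mul_le_of_le_one_right (hq0 k) ?_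
      have : |if k.2.2 then (1 : ℝ) else -1| = 1 := by split_ifs <;> simp
      rw [this, one_mul]
      exact hE _ _ _ _ _) hε'
  refine (hψ.2 t ht h x ν hν).trans ?_
  rw [add_comm ε]
  gcongr
  refine ciSup_le fun y => le_trans (le_of_eq ?_) (hbias y)
  refine Finset.sum_congr rfl fun k _ => ?_
  unfold gain
  rw [← integral_const_mul, ← integral_const_mul]
  refine integral_congr_ae (Filter.Eventually.of_forall fun p => ?_)
  simp only [hq]
  ring

/-- The signed conditional bias in round `t` of a path. -/
def pathGain (E : EventFamily κ 𝒳 d) (ψ : Forecaster 𝒳 d) (x : ℕ → 𝒳) (p y : ℕ → Cube d) (t : ℕ)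
    (k : Expert κ d) : ℝ :=
  gain E (ψ t (pathTranscript x p y t, x t)) t (pathTranscript x p y t) (x t) (y t) k

lemma expertWeight_path (W : ℝ → ℝ → ℝ) (x : ℕ → 𝒳) (p y : ℕ → Cube d) (t : ℕ) (k : Expert κ d) :
    expertWeight E ψ W (pathTranscript x p y t) k =
      W (∑ s ∈ Finset.range t, pathGain E ψ x p y s k)
        (∑ s ∈ Finset.range t, pathGain E ψ x p y s k ^ 2) /
      ∑ k', W (∑ s ∈ Finset.range t, pathGain E ψ x p y s k')
        (∑ s ∈ Finset.range t, pathGain E ψ x p y s k' ^ 2) := by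
  simp_rw [← Fin.sum_univ_eq_sum_range]
  rfl

lemma IsUnbiasedPrediction.mul_sum_pathGain_le (hE : ∀ e t h x p, |E e t h x p| ≤ 1) {T : ℕ}
    (hT : 0 < T) (hψ : IsUnbiasedPrediction E ψ (multiscaleWeight T) (1 / (T : ℝ)) T)
    (x : ℕ → 𝒳) (p y : ℕ → Cube d) (k : Expert κ d) {m : ℕ} (hm : m < Nat.log 2 T + 1) :
    (2⁻¹ : ℝ) ^ (m + 1) * ∑ s ∈ Finset.range T, pathGain E ψ x p y s k -
        ((2⁻¹ : ℝ) ^ (m + 1)) ^ 2 * ∑ s ∈ Finset.range T, pathGain E ψ x p y s k ^ 2 ≤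
      Real.log (2 * (Fintype.card (Expert κ d) * (Nat.log 2 T + 1))) := by
  have := hψ.1
  refine mul_sum_sub_sq_mul_sum_sq_le (fun t k => pathGain E ψ x p y t k) hT
    (fun t _ k => abs_gain_le _ _ (hE k.1 t _ _)) (fun t ht => ?_) k hm
  have h := objective_le_of_isUnbiasedPrediction hE (multiscaleWeight_pos T) hψ ht
    (pathTranscript x p y t) (x t) (y t)
  unfold objective at h
  simp_rw [expertWeight_path, div_mul_eq_mul_div] at h
  rw [← Finset.sum_div, div_le_iff₀] at h
  · exact h
  · exact Finset.sum_pos (fun k _ => multiscaleWeight_pos T _ _) ⟨k, Finset.mem_univ k⟩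

end UnbiasedPath

/-! ### Optimizing over the dyadic learning rates. -/

section Tuning

/-- Choice of the learning rate. -/
lemma le_sqrt_of_forall_learning_rate {T : ℕ} {n Λ G : ℝ} (hΛ : Real.log 2 ≤ Λ) (hΛn : Λ ≤ n)
    (hnT : n ≤ T) (h : ∀ m < Nat.log 2 T + 1,
      (2⁻¹ : ℝ) ^ (m + 1) * G - ((2⁻¹ : ℝ) ^ (m + 1)) ^ 2 * n ≤ 3 * Λ) :
    G ≤ 7 * √(n * Λ) := by
  have hlog2 := Real.log_two_gt_d9
  have hΛ0 : 0 < Λ := by linarith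
  have hn0 : 0 < n := by linarith
  -- The ideal rate up to a constant; the dyadic rate `η` chosen below satisfies `η < r ≤ 2η`.
  set r := √(Λ / n) with hr
  have hr0 : 0 < r := Real.sqrt_pos.2 (by positivity)
  have hr1 : r ≤ 1 := by
    rw [hr, ← Real.sqrt_one]
    exact Real.sqrt_le_sqrt ((div_le_one hn0).2 hΛn)
  have hr2 : r ^ 2 = Λ / n := Real.sq_sqrt (by positivity)
  obtain ⟨m, hm1, hm2⟩ := exists_nat_pow_near_of_lt_one hr0 hr1 (y := (2⁻¹ : ℝ)) (by norm_num)
    (by norm_num)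
  -- The grid reaches far enough: otherwise `r ≤ 2⁻ᵐ ≤ 1 / (T + 1)`, contradicting `r² = Λ / n ≥ log
  -- 2 / T`.
  have hmT : m < Nat.log 2 T + 1 := by
    by_contra hcon
    have h1 : T + 1 ≤ 2 ^ m := (Nat.lt_pow_succ_log_self (by norm_num) T).trans_le
      (Nat.pow_le_pow_right (by norm_num) (not_lt.1 hcon))
    have h2 : (T : ℝ) + 1 ≤ 2 ^ m := by exact_mod_cast h1
    have h3 : r * 2 ^ m ≤ 1 := by
      rw [inv_pow] at hm2
      calc r * 2 ^ m ≤ (2 ^ m)⁻¹ * 2 ^ m := by gcongr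
        _ = 1 := inv_mul_cancel₀ (by positivity)
    have h4 : r * (T + 1) ≤ 1 := le_trans (by gcongr) h3
    have h5 : (r * (T + 1)) ^ 2 ≤ 1 := pow_le_one₀ (by positivity) h4
    rw [mul_pow, hr2, div_mul_eq_mul_div, div_le_one hn0] at h5
    have hT0 : (0 : ℝ) ≤ T := by positivity
    nlinarith
  set η := (2⁻¹ : ℝ) ^ (m + 1) with hη
  have hη0 : 0 < η := by positivity
  have hηr : r ≤ 2 * η := by
    refine hm2.trans (le_of_eq ?_)
    rw [hη, pow_succ]; ring
  have hs : √(n * Λ) = r * n := by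
    rw [Real.sqrt_eq_iff_mul_self_eq_of_pos (by positivity)]
    rw [← pow_two, mul_pow, hr2]; field_simp
  have h1 : η * G - η ^ 2 * n ≤ 3 * Λ := h m hmT
  have h2 : G ≤ η * n + 3 * Λ / η := by
    rw [← sub_le_iff_le_add', le_div_iff₀ hη0]
    linarith
  -- The two terms contribute `1` and `6` times `r n = √(n Λ)`, which gives the constant `7`.
  have h3 : η * n ≤ r * n := by gcongr
  have h4 : 3 * Λ / η ≤ 6 * (r * n) := by
    rw [div_le_iff₀ hη0]
    have : Λ = r ^ 2 * n := by rw [hr2]; field_simp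
    calc 3 * Λ = 3 * (r * n) * r := by rw [this]; ring
      _ ≤ 3 * (r * n) * (2 * η) := by gcongr
      _ = _ := by ring
  rw [hs]
  linarith

end Tuning

/-! ### Concentration of realized bias around expected bias. -/

section Noise

lemma measurable_integral_prod_of_measurable {α E F : Type*} [MeasurableSpace α]
    [MeasurableSpace E] [MeasurableSpace F] {κ : α → Measure E} (hκ : Measurable κ)
    (hp : ∀ a, IsProbabilityMeasure (κ a)) {φ : (α × E) × F → ℝ} (hφ : Measurable φ) :
    Measurable fun z : α × F => ∫ e, φ ((z.1, e), z.2) ∂κ z.1 := by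
  let K : Kernel α E := ⟨κ, hκ⟩
  have : IsMarkovKernel K := ⟨hp⟩
  have hm : Measurable fun w : (α × F) × E => φ ((w.1.1, w.2), w.1.2) :=
    hφ.comp (Measurable.prodMk (Measurable.prodMk (measurable_fst.comp measurable_fst)
      measurable_snd) (measurable_snd.comp measurable_fst))
  exact (hm.stronglyMeasurable.integral_kernel_prod_right'
    (κ := K.comap Prod.fst measurable_fst)).measurable

lemma measurable_lintegral_prod_of_measurable {α E F : Type*} [MeasurableSpace α]
    [MeasurableSpace E] [MeasurableSpace F] {κ : α → Measure F} (hκ : Measurable κ)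
    (hp : ∀ a, IsProbabilityMeasure (κ a)) {Z : (α × E) × F → ℝ≥0∞} (hZ : Measurable Z) :
    Measurable fun z : α × E => ∫⁻ w, Z (z, w) ∂κ z.1 := by
  let K : Kernel α F := ⟨κ, hκ⟩
  have : IsMarkovKernel K := ⟨hp⟩
  exact hZ.lintegral_kernel_prod_right' (κ := K.comap Prod.fst measurable_fst)

lemma measurable_noise_exp {α E F : Type*} [MeasurableSpace α]
    [MeasurableSpace E] [MeasurableSpace F] {κ : α → Measure E} (hκ : Measurable κ)
    (hp : ∀ a, IsProbabilityMeasure (κ a)) {φ : (α × E) × F → ℝ} (hφ : Measurable φ)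
    {b : α → ℝ} (hb : Measurable b) {g : α → ℝ≥0∞} (hg : Measurable g) (l : ℝ) :
    Measurable fun z : (α × E) × F => g z.1.1 * ENNReal.ofReal (Real.exp
      (l * (φ z - ∫ e, φ ((z.1.1, e), z.2) ∂κ z.1.1) - l ^ 2 / 2 * b z.1.1)) := by
  have h1 : Measurable fun z : (α × E) × F => z.1.1 := measurable_fst.comp measurable_fst
  have h2 : Measurable fun z : (α × E) × F => ∫ e, φ ((z.1.1, e), z.2) ∂κ z.1.1 :=
    (measurable_integral_prod_of_measurable hκ hp hφ).comp (h1.prodMk measurable_snd)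
  exact (hg.comp h1).mul (ENNReal.measurable_ofReal.comp (Real.measurable_exp.comp
    (((hφ.sub h2).const_mul l).sub ((hb.comp h1).const_mul _))))

/-- The error is centered over the prediction for each fixed outcome. Under the product law Tonelli
allows the prediction to be integrated first, and Hoeffding's lemma applies outcome by outcome. The
indicator `b` charges variance only in active rounds. -/
lemma lintegral_noise_exp_le {α E F : Type*} [MeasurableSpace α]
    [MeasurableSpace E] [MeasurableSpace F] {κ : α → Measure E} (hκ : Measurable κ)
    (hp : ∀ a, IsProbabilityMeasure (κ a)) {ρ : Measure F} [IsProbabilityMeasure ρ]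
    {φ : (α × E) × F → ℝ} (hφ : Measurable φ)
    {b : α → ℝ} (hb : Measurable b) {g : α → ℝ≥0∞} (hg : Measurable g)
    (hb1 : ∀ a, (b a = 1 ∧ ∀ p y, φ ((a, p), y) ∈ Set.Icc (-1 : ℝ) 1) ∨
      (b a = 0 ∧ ∀ p y, φ ((a, p), y) = 0)) (l : ℝ) (a : α) :
    ∫⁻ p, ∫⁻ y, g a * ENNReal.ofReal (Real.exp
      (l * (φ ((a, p), y) - ∫ e, φ ((a, e), y) ∂κ a) - l ^ 2 / 2 * b a)) ∂ρ ∂κ a ≤ g a := by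
  have := hp a
  have hm : Measurable (Function.uncurry fun (p : E) (y : F) => g a * ENNReal.ofReal (Real.exp
      (l * (φ ((a, p), y) - ∫ e, φ ((a, e), y) ∂κ a) - l ^ 2 / 2 * b a))) :=
    (measurable_noise_exp hκ hp hφ hb hg l).comp
      (show Measurable fun w : E × F => ((a, w.1), w.2) by fun_prop)
  rw [lintegral_lintegral_swap hm.aemeasurable]
  refine (lintegral_mono (g := fun _ => g a) fun y => ?_).trans (by simp)
  rcases hb1 a with ⟨hb, hφa⟩ | ⟨hb, hφa⟩
  · have hφy : Measurable fun p => φ ((a, p), y) :=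
      hφ.comp (show Measurable fun p : E => ((a, p), y) by fun_prop)
    rw [hb, lintegral_const_mul _ (by fun_prop)]
    have := lintegral_exp_centered_le (κ a) hφy (a := -1) (fun p => by
      have := hφa p y; exact ⟨this.1, by linarith [this.2]⟩) l
    calc _ ≤ g a * 1 := by gcongr; simpa using this
      _ = g a := mul_one _
  · simp [hb, hφa]

variable {𝒳 : Type uX} [MeasurableSpace 𝒳] {𝒜 : Type uA} [Fintype 𝒜] {𝒩 : Type uN} [Fintype 𝒩]
  {d J I : ℕ} {L : ℝ} {P : Setup 𝒳 𝒜 𝒩 d J I L}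
  {Ω : Type uO} [mΩ : MeasurableSpace Ω] {μ : Measure Ω} {𝓕 : Filtration ℕ mΩ} {x : ℕ → Ω → 𝒳}
  {D : ℕ → Ω → Measure (Cube d)} {p y : ℕ → Ω → Cube d} {ψ : Forecaster 𝒳 d}

/-- The transcript before round `t` and the feature of round `t`. -/
def history (x : ℕ → Ω → 𝒳) (p y : ℕ → Ω → Cube d) (t : ℕ) (ω : Ω) : Transcript 𝒳 d t × 𝒳 :=
  (pathTranscript (fun s => x s ω) (fun s => p s ω) (fun s => y s ω) t, x t ω)

/-- Given the past, prediction and outcome are independent with laws `ψ t` and `D t`. -/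
lemma Setup.IsInteraction.lintegral_prediction_outcome [IsProbabilityMeasure μ]
    (hI : P.IsInteraction μ 𝓕 x D p y) (hψ : ∀ t, IsMarkovKernel (ψ t))
    (hfol : FollowsForecaster μ 𝓕 P.T x p y ψ) {t : ℕ} (ht : t < P.T)
    {Z : (Ω × Cube d) × Cube d → ℝ≥0∞}
    (hZ : Measurable[((𝓕 t).prod inferInstance).prod inferInstance] Z) :
    ∫⁻ ω, Z ((ω, p t ω), y t ω) ∂μ =
      ∫⁻ ω, ∫⁻ q, ∫⁻ w, Z ((ω, q), w) ∂D t ω ∂ψ t (history x p y t ω) ∂μ := by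
  have hle := (hI.outcomeInfo_le ht).trans (𝓕.le _)
  have hD : Measurable[outcomeInfo 𝓕 p t] (D t) := (hI.D_measurable t ht).mono le_sup_left le_rfl
  have hp' : Measurable[outcomeInfo 𝓕 p t] (p t) := (comap_measurable (p t)).mono le_sup_right le_rfl
  have hmap : @Measurable _ _ ((outcomeInfo 𝓕 p t).prod inferInstance)
      (((𝓕 t).prod inferInstance).prod inferInstance)
      (fun z : Ω × Cube d => ((z.1, p t z.1), z.2)) := by
    have h1 : @Measurable _ _ ((outcomeInfo 𝓕 p t).prod inferInstance) (outcomeInfo 𝓕 p t)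
      (fun z : Ω × Cube d => z.1) := @measurable_fst _ _ (outcomeInfo 𝓕 p t) _
    have h2 : @Measurable _ _ ((outcomeInfo 𝓕 p t).prod inferInstance) _
      (fun z : Ω × Cube d => z.2) := @measurable_snd _ _ (outcomeInfo 𝓕 p t) _
    exact Measurable.prodMk (Measurable.prodMk (h1.mono le_rfl le_sup_left) (hp'.comp h1)) h2
  -- The outcome is integrated out given the past and the prediction, then the prediction given the
  -- past. Since `D t` is known before the prediction, the result is an integral against a product
  -- law.
  have hy := lintegral_of_condExp_law hle hD (hI.D_prob t ht)
    ((hI.y_measurable t ht).mono (𝓕.le _) le_rfl) (hI.y_law t ht) (hZ.comp hmap)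
  refine hy.trans ?_
  have hinner : Measurable[(𝓕 t).prod inferInstance]
      (fun z : Ω × Cube d => ∫⁻ w, Z (z, w) ∂D t z.1) :=
    @measurable_lintegral_prod_of_measurable Ω (Cube d) (Cube d) (𝓕 t) _ _ _
      (hI.D_measurable t ht) (hI.D_prob t ht) _ hZ
  have hψm : Measurable[𝓕 t] fun ω => ψ t (history x p y t ω) :=
    (ψ t).measurable.comp (hI.measurable_history ht)
  exact lintegral_of_condExp_law (𝓕.le t) hψm (fun ω => (hψ t).isProbabilityMeasure _)
    ((hI.p_measurable t ht).mono (𝓕.le _) le_rfl) (hfol t ht) hinner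

/-- The sampling error of the signed bias in round `t` of a path. -/
def Setup.samplingError (P : Setup 𝒳 𝒜 𝒩 d J I L) (ψ : Forecaster 𝒳 d) (x : ℕ → 𝒳)
    (p y : ℕ → Cube d) (k : Expert (𝒩 × 𝒜 × Fin I) d) (t : ℕ) : ℝ :=
  (if k.2.2 then 1 else -1) * (P.events k.1 t (pathTranscript x p y t) (x t) (p t) *
    ((p t : Fin d → ℝ) k.2.1 - (y t : Fin d → ℝ) k.2.1)) - pathGain P.events ψ x p y t k

/-- Errors vanish in rounds outside the subsequence, and activity is known before the prediction is
drawn, so the total variance proxy is `|S|`. -/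
lemma Setup.IsInteraction.measure_samplingError_gt_le [IsProbabilityMeasure μ]
    (hI : P.IsInteraction μ 𝓕 x D p y) (hψ : ∀ t, IsMarkovKernel (ψ t))
    (hfol : FollowsForecaster μ 𝓕 P.T x p y ψ) (k : Expert (𝒩 × 𝒜 × Fin I) d) {τ : ℝ}
    (hτ : 0 ≤ τ) (hlen : 0 < P.len k.1.2.2) :
    μ {ω | τ < ∑ t ∈ Finset.range P.T, P.samplingError ψ (fun s => x s ω) (fun s => p s ω)
      (fun s => y s ω) k t} ≤ ENNReal.ofReal (Real.exp (-(τ ^ 2 / (2 * P.len k.1.2.2)))) := by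
  classical
  set σ : ℝ := if k.2.2 then 1 else -1 with hσ
  have hσ1 : |σ| = 1 := by rw [hσ]; split_ifs <;> simp
  let φ : ∀ t, (Ω × Cube d) × Cube d → ℝ := fun t z =>
    σ * (P.events k.1 t (history x p y t z.1.1).1 (history x p y t z.1.1).2 z.1.2 *
      ((z.1.2 : Fin d → ℝ) k.2.1 - (z.2 : Fin d → ℝ) k.2.1))
  let b : ℕ → Ω → ℝ := fun t ω => if x t ω ∈ P.sub k.1.2.2 t then 1 else 0
  let X : ℕ → Ω → ℝ := fun t ω => P.samplingError ψ (fun s => x s ω) (fun s => p s ω)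
      (fun s => y s ω) k t
  have hX : ∀ t ω, X t ω = φ t ((ω, p t ω), y t ω) -
      ∫ e, φ t ((ω, e), y t ω) ∂ψ t (history x p y t ω) := fun t ω => by
    simp only [X, φ, Setup.samplingError, pathGain, gain, history, integral_const_mul, hσ]
  have hφm : ∀ t < P.T, Measurable[((𝓕 t).prod inferInstance).prod inferInstance] (φ t) := by
    intro t ht
    have h0 : @Measurable _ _ (((𝓕 t).prod inferInstance).prod inferInstance)
        ((𝓕 t).prod inferInstance) (fun z : (Ω × Cube d) × Cube d => z.1) :=
      @measurable_fst _ _ ((𝓕 t).prod inferInstance) _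
    have h1 : @Measurable _ _ (((𝓕 t).prod inferInstance).prod inferInstance) (𝓕 t)
        (fun z : (Ω × Cube d) × Cube d => z.1.1) := (@measurable_fst _ _ (𝓕 t) _).comp h0
    have h2 : @Measurable _ _ (((𝓕 t).prod inferInstance).prod inferInstance) _
        (fun z : (Ω × Cube d) × Cube d => z.1.2) := (@measurable_snd _ _ (𝓕 t) _).comp h0
    have h3 : @Measurable _ _ (((𝓕 t).prod inferInstance).prod inferInstance) _
        (fun z : (Ω × Cube d) × Cube d => z.2) := @measurable_snd _ _ ((𝓕 t).prod inferInstance) _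
    have hE : @Measurable _ _ (((𝓕 t).prod inferInstance).prod inferInstance) _
        (fun z : (Ω × Cube d) × Cube d =>
          P.events k.1 t (history x p y t z.1.1).1 (history x p y t z.1.1).2 z.1.2) :=
      (P.measurable_events k.1 t).comp (((hI.measurable_history ht).comp h1).prodMk h2)
    refine Measurable.const_mul (hE.mul (Measurable.sub ?_ ?_)) _
    · exact (measurable_pi_apply _).comp (measurable_subtype_coe.comp h2)
    · exact (measurable_pi_apply _).comp (measurable_subtype_coe.comp h3)
  have hκm : ∀ t < P.T, Measurable[𝓕 t] fun ω => ψ t (history x p y t ω) := fun t ht =>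
    (ψ t).measurable.comp (hI.measurable_history ht)
  have hκp : ∀ t ω, IsProbabilityMeasure (ψ t (history x p y t ω)) := fun t ω =>
    (hψ t).isProbabilityMeasure _
  have hbm : ∀ t < P.T, Measurable[𝓕 t] (b t) := fun t ht =>
    Measurable.ite (hI.x_measurable t ht (P.sub_measurable k.1.2.2 t)) measurable_const
      measurable_const
  have hXm : ∀ t < P.T, Measurable[𝓕 (t + 1)] (X t) := by
    intro t ht
    have hid : @Measurable Ω Ω (𝓕 (t + 1)) (𝓕 t) id := measurable_id'' (𝓕.mono t.le_succ)
    have h1 : Measurable[𝓕 (t + 1)] fun ω => φ t ((ω, p t ω), y t ω) :=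
      (hφm t ht).comp ((hid.prodMk (hI.p_measurable t ht)).prodMk (hI.y_measurable t ht))
    have h2 : Measurable[𝓕 (t + 1)] fun ω =>
        ∫ e, φ t ((ω, e), y t ω) ∂ψ t (history x p y t ω) :=
      (@measurable_integral_prod_of_measurable _ _ _ (𝓕 t) _ _ _ (hκm t ht) (hκp t) _
        (hφm t ht)).comp (hid.prodMk (hI.y_measurable t ht))
    have h3 : X t = fun ω => φ t ((ω, p t ω), y t ω) -
      ∫ e, φ t ((ω, e), y t ω) ∂ψ t (history x p y t ω) := funext (hX t)
    rw [h3]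
    exact h1.sub h2
  have hb1 : ∀ t ω, (b t ω = 1 ∧ ∀ q w, φ t ((ω, q), w) ∈ Set.Icc (-1 : ℝ) 1) ∨
      (b t ω = 0 ∧ ∀ q w, φ t ((ω, q), w) = 0) := by
    intro t ω
    by_cases hx : x t ω ∈ P.sub k.1.2.2 t
    · refine Or.inl ⟨if_pos hx, fun q w => abs_le.1 ?_⟩
      simp only [φ]
      rw [abs_mul, hσ1, one_mul, abs_mul]
      exact mul_le_one₀ (P.abs_events_le_one _ _ _ _ _) (abs_nonneg _) (Cube.abs_sub_le_one _ _ _)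
    · refine Or.inr ⟨if_neg hx, fun q w => ?_⟩
      have : P.events k.1 t (history x p y t ω).1 (history x p y t ω).2 q = 0 :=
        if_neg fun h => hx h.1
      simp only [φ, this, zero_mul, mul_zero]
  refine measure_sum_gt_le P.T X b (by exact_mod_cast hlen) hτ (fun l hl => ?_) ?_
    (fun t ht => (hXm t ht).mono (𝓕.le _) le_rfl) (fun t ht => (hbm t ht).mono (𝓕.le _) le_rfl)
  · refine lintegral_exp_sum_le_one 𝓕 P.T (fun t ω => l * X t ω - l ^ 2 / 2 * b t ω)
      (fun t ht => ((hXm t ht).const_mul _).sub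
        (((hbm t ht).mono (𝓕.mono t.le_succ) le_rfl).const_mul _)) fun t ht f hf => ?_
    have hdis := hI.lintegral_prediction_outcome hψ hfol ht
      (@measurable_noise_exp Ω _ _ (𝓕 t) _ _ _ (hκm t ht) (hκp t) _ (hφm t ht) _ (hbm t ht) _ hf l)
    simp_rw [hX]
    refine (le_of_eq hdis).trans (lintegral_mono fun ω => ?_)
    have := hI.D_prob t ht ω
    exact @lintegral_noise_exp_le Ω _ _ (𝓕 t) _ _ _ (hκm t ht) (hκp t) _ _ _ (hφm t ht) _ (hbm t ht)
      _ hf (hb1 t) l ω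
  · filter_upwards [hI.length] with ω hω
    rw [← hω k.1.2.2]
    simp only [b]
    rw [Finset.sum_boole, Nat.cast_le]
    exact le_of_eq (by unfold Setup.subseq; congr)

end Noise

/-! ### Deterministic bias and regret bounds on a subsequence. -/

section Subsequence

variable {𝒳 : Type uX} [MeasurableSpace 𝒳] {𝒜 : Type uA} [Fintype 𝒜] {𝒩 : Type uN} [Fintype 𝒩]
  {d J I : ℕ} {L : ℝ} {P : Setup 𝒳 𝒜 𝒩 d J I L}

/-- The argument of the logarithm in the regret bound. -/
def Setup.complexity (P : Setup 𝒳 𝒜 𝒩 d J I L) : ℝ :=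
  (d : ℝ) * Fintype.card 𝒜 * Fintype.card 𝒩 * I * P.T / P.δ

lemma Setup.card_expert_le (hδ : 0 < P.δ) (hδ1 : P.δ < 1) :
    (Fintype.card (Expert (𝒩 × 𝒜 × Fin I) d) : ℝ) * P.T ≤ 2 * (P.δ * P.complexity) ∧
      P.δ * P.complexity ≤ P.complexity := by
  have h0 : 0 ≤ P.complexity := by unfold Setup.complexity; positivity
  refine ⟨le_of_eq ?_, mul_le_of_le_one_left h0 hδ1.le⟩
  simp only [Setup.complexity, Expert, Fintype.card_prod, Fintype.card_fin, Fintype.card_bool]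
  push_cast
  field_simp

/-- The expert `k` serves only to make `d`, `I` and `𝒩` nonzero; the `2` comes from `|𝒜|`. -/
lemma Setup.two_le_complexity (hδ : 0 < P.δ) (hδ1 : P.δ < 1) (hT : 0 < P.T)
    (hA : 2 ≤ Fintype.card 𝒜) (k : Expert (𝒩 × 𝒜 × Fin I) d) : 2 ≤ P.complexity := by
  have hd : 1 ≤ d := Nat.one_le_iff_ne_zero.2 fun h => by subst h; exact k.2.1.elim0
  have hI : 1 ≤ I := Nat.one_le_iff_ne_zero.2 fun h => by subst h; exact k.1.2.2.elim0
  have hN : 1 ≤ Fintype.card 𝒩 := Fintype.card_pos_iff.2 ⟨k.1.1⟩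
  have h1 : 2 ≤ d * Fintype.card 𝒜 * Fintype.card 𝒩 * I * P.T := by
    calc 2 = 1 * 2 * 1 * 1 * 1 := rfl
      _ ≤ _ := by gcongr; exact hT
  unfold Setup.complexity
  rw [le_div_iff₀ hδ]
  have h2 : (2 : ℝ) ≤ (d : ℝ) * Fintype.card 𝒜 * Fintype.card 𝒩 * I * P.T := by exact_mod_cast h1
  linarith

lemma Setup.log_experts_le (hδ : 0 < P.δ) (hδ1 : P.δ < 1) (hT : 0 < P.T)
    (hA : 2 ≤ Fintype.card 𝒜) (k : Expert (𝒩 × 𝒜 × Fin I) d) :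
    Real.log (2 * (Fintype.card (Expert (𝒩 × 𝒜 × Fin I) d) * (Nat.log 2 P.T + 1))) ≤
      3 * Real.log P.complexity := by
  have hK := P.two_le_complexity hδ hδ1 hT hA k
  obtain ⟨h1, h2⟩ := P.card_expert_le hδ hδ1
  have hE : (0 : ℝ) < Fintype.card (Expert (𝒩 × 𝒜 × Fin I) d) := by
    exact_mod_cast Fintype.card_pos_iff.2 ⟨k⟩
  have hlog : ((Nat.log 2 P.T : ℕ) : ℝ) + 1 ≤ P.T := by
    exact_mod_cast Nat.log_lt_self 2 hT.ne'
  -- Bounding `log₂ T + 1` by `T` gives at most `4` times the complexity, and the complexity is at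
  -- least `2`.
  have h3 : 2 * (Fintype.card (Expert (𝒩 × 𝒜 × Fin I) d) * ((Nat.log 2 P.T : ℕ) + 1 : ℝ)) ≤
      P.complexity ^ 3 := by
    have : (Fintype.card (Expert (𝒩 × 𝒜 × Fin I) d) * ((Nat.log 2 P.T : ℕ) + 1 : ℝ)) ≤
      Fintype.card (Expert (𝒩 × 𝒜 × Fin I) d) * P.T := by gcongr
    nlinarith [mul_nonneg (sub_nonneg.2 hK) (sub_nonneg.2 hK),
      mul_nonneg (mul_nonneg (sub_nonneg.2 hK) (sub_nonneg.2 hK)) (sub_nonneg.2 hK)]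
  calc _ ≤ Real.log (P.complexity ^ 3) := Real.log_le_log (by positivity) h3
    _ = _ := by rw [Real.log_pow]; norm_num

variable {x : ℕ → 𝒳} {p y : ℕ → Cube d} {ψ : Forecaster 𝒳 d}

/-- Gains vanish outside the subsequence and are at most one on it, so the cumulative squared gain
is at most `|S|`; this is why the bound scales with `|S|` instead of `T`. -/
lemma Setup.sum_pathGain_le (hδ : 0 < P.δ) (hδ1 : P.δ < 1) (hT : 0 < P.T)
    (hA : 2 ≤ Fintype.card 𝒜) (hψ : P.IsDecisionCalibrationSubsequence ψ)
    (k : Expert (𝒩 × 𝒜 × Fin I) d)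
    (hn : Real.log P.complexity ≤ (P.subseq x k.1.2.2).card) :
    ∑ t ∈ Finset.range P.T, pathGain P.events ψ x p y t k ≤
      7 * √((P.subseq x k.1.2.2).card * Real.log P.complexity) := by
  classical
  have hmk := hψ.1
  refine le_sqrt_of_forall_learning_rate (T := P.T)
    (Real.log_le_log (by norm_num) (P.two_le_complexity hδ hδ1 hT hA k)) hn ?_ fun m hm => ?_
  · unfold Setup.subseq
    exact_mod_cast (Finset.card_filter_le _ _).trans_eq (Finset.card_range _)
  · have h1 := hψ.mul_sum_pathGain_le P.abs_events_le_one hT x p y k hm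
    have h2 : ∑ t ∈ Finset.range P.T, pathGain P.events ψ x p y t k ^ 2 ≤
        (P.subseq x k.1.2.2).card := by
      calc _ ≤ ∑ t ∈ Finset.range P.T, (if x t ∈ P.sub k.1.2.2 t then (1 : ℝ) else 0) := by
            refine Finset.sum_le_sum fun t _ => ?_
            have h3 : |pathGain P.events ψ x p y t k| ≤
                if x t ∈ P.sub k.1.2.2 t then (1 : ℝ) else 0 :=
              abs_gain_le _ _ fun q => by
                convert P.abs_events_le k.1 t (pathTranscript x p y t) (x t) q
            rw [← sq_abs]
            split_ifs at h3 ⊢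
            · exact pow_le_one₀ (abs_nonneg _) h3
            · exact (pow_le_pow_left₀ (abs_nonneg _) h3 2).trans (by norm_num)
        _ = _ := by
            rw [Finset.sum_boole, Nat.cast_inj]
            unfold Setup.subseq
            congr
    have h4 := P.log_experts_le hδ hδ1 hT hA k
    have h5 : ((2⁻¹ : ℝ) ^ (m + 1)) ^ 2 * ∑ t ∈ Finset.range P.T, pathGain P.events ψ x p y t k ^ 2
        ≤ ((2⁻¹ : ℝ) ^ (m + 1)) ^ 2 * (P.subseq x k.1.2.2).card := by gcongr
    linarith

/-- The bias on the rounds of a subsequence in which an agent plays a given action. -/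
lemma Setup.norm_bias_le (hδ : 0 < P.δ) (hδ1 : P.δ < 1) (hT : 0 < P.T)
    (hA : 2 ≤ Fintype.card 𝒜) (hψ : P.IsDecisionCalibrationSubsequence ψ) (n : 𝒩) (a : 𝒜)
    (i : Fin I) (hn : Real.log P.complexity ≤ (P.subseq x i).card)
    (hnoise : ∀ k : Expert (𝒩 × 𝒜 × Fin I) d, ∑ t ∈ Finset.range P.T,
      P.samplingError ψ x p y k t ≤
        √(6 * ((P.subseq x k.1.2.2).card * Real.log P.complexity))) :
    open Classical in ‖∑ t ∈ (P.subseq x i).filter (fun t => P.pathAction x p y n t = a),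
        ((p t : Fin d → ℝ) - (y t : Fin d → ℝ))‖ ≤
      10 * √((P.subseq x i).card * Real.log P.complexity) := by
  classical
  set s := √((P.subseq x i).card * Real.log P.complexity) with hs
  have hs0 : 0 ≤ s := Real.sqrt_nonneg _
  have hsix : √(6 * ((P.subseq x i).card * Real.log P.complexity)) ≤ 3 * s := by
    rw [Real.sqrt_mul (by norm_num)]
    gcongr
    exact Real.sqrt_le_iff.2 ⟨by norm_num, by norm_num⟩
  -- Expected bias contributes `7` and the sampling error `√6 ≤ 3`. Using both signs bounds the
  -- absolute value of each coordinate.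
  have hk : ∀ (j : Fin d) (b : Bool), (if b then (1 : ℝ) else -1) *
      ∑ t ∈ (P.subseq x i).filter (fun t => P.pathAction x p y n t = a),
        ((p t : Fin d → ℝ) j - (y t : Fin d → ℝ) j) ≤ 10 * s := by
    intro j b
    have h1 := hnoise ((n, a, i), j, b)
    have h2 := P.sum_pathGain_le (p := p) (y := y) hδ hδ1 hT hA hψ ((n, a, i), j, b) hn
    simp only [Setup.samplingError, Finset.sum_sub_distrib, ← Finset.mul_sum] at h1
    have h3 : ∑ t ∈ (P.subseq x i).filter (fun t => P.pathAction x p y n t = a),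
        ((p t : Fin d → ℝ) j - (y t : Fin d → ℝ) j) =
        ∑ t ∈ Finset.range P.T, P.events (n, a, i) t (pathTranscript x p y t) (x t) (p t) *
          ((p t : Fin d → ℝ) j - (y t : Fin d → ℝ) j) := by
      unfold Setup.subseq Setup.events
      rw [Finset.filter_filter, Finset.sum_filter]
      refine Finset.sum_congr rfl fun t _ => ?_
      rw [ite_mul, one_mul, zero_mul]
      exact if_congr Iff.rfl rfl rfl
    rw [h3]
    linarith
  refine (pi_norm_le_iff_of_nonneg (by positivity)).2 fun j => ?_
  rw [Finset.sum_apply, Real.norm_eq_abs, abs_le']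
  simp only [Pi.sub_apply]
  have h1 := hk j true
  have h2 := hk j false
  simp only [if_true, one_mul, Bool.false_eq_true, if_false, neg_one_mul] at h1 h2
  exact ⟨h1, h2⟩

/-- Long subsequences use a constant `β`, hence `20 = 2 · 10`. If `|S|` is below the logarithm, then
`|S|` is at most the square root and the trivial bound suffices. For `d = 0` the complexity is `0`,
`Real.log 0 = 0`, and the first case applies with no coordinates to check. -/
lemma Setup.swapRegret_le_sqrt (hL : 0 ≤ L) (hδ : 0 < P.δ) (hδ1 : P.δ < 1) (hT : 0 < P.T)
    (hA : 2 ≤ Fintype.card 𝒜) (hψ : P.IsDecisionCalibrationSubsequence ψ) (n : 𝒩)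
    (i : Fin I) {B : Set 𝒜} (hB : B.Nonempty)
    (hcand : ∀ b ∈ B, ∀ t ∈ P.subseq x i, b ∈ (P.pathState x p y n t).cand i)
    (hnoise : ∀ k : Expert (𝒩 × 𝒜 × Fin I) d, ∑ t ∈ Finset.range P.T,
      P.samplingError ψ x p y k t ≤
        √(6 * ((P.subseq x k.1.2.2).card * Real.log P.complexity))) :
    swapRegret (P.agent n).u B (P.subseq x i) (P.pathAction x p y n) y ≤
      20 * L * (Fintype.card 𝒜 : ℝ) * √((P.subseq x i).card * Real.log P.complexity) := by
  rcases le_or_gt (Real.log P.complexity) (P.subseq x i).card with hn | hn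
  · refine (P.swapRegret_le_of_bias_le (fun a => P.norm_bias_le hδ hδ1 hT hA hψ n a i hn hnoise)
      hL (concaveOn_const _ (convex_Ici 0)) hB hcand).trans (le_of_eq (by ring))
  · refine ((P.agent n).swapRegret_le_card hL hB).trans ?_
    have hA' : (1 : ℝ) ≤ Fintype.card 𝒜 := by exact_mod_cast (by omega : 1 ≤ Fintype.card 𝒜)
    have h1 : ((P.subseq x i).card : ℝ) ≤ √((P.subseq x i).card * Real.log P.complexity) := by
      refine Real.le_sqrt_of_sq_le ?_
      rw [pow_two]
      gcongr
    calc L * ((P.subseq x i).card : ℝ)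
        ≤ L * √((P.subseq x i).card * Real.log P.complexity) := by gcongr
      _ ≤ 20 * L * 1 * √((P.subseq x i).card * Real.log P.complexity) := by
          rw [mul_one]; gcongr; linarith
      _ ≤ _ := by gcongr

end Subsequence

/-! ### The high-probability regret bound for the algorithm. -/

section Main

variable {𝒳 : Type uX} [MeasurableSpace 𝒳] {𝒜 : Type uA} [Fintype 𝒜] {𝒩 : Type uN} [Fintype 𝒩]
  {d J I : ℕ} {L : ℝ} {P : Setup 𝒳 𝒜 𝒩 d J I L}
  {Ω : Type uO} [mΩ : MeasurableSpace Ω] {μ : Measure Ω} {𝓕 : Filtration ℕ mΩ} {x : ℕ → Ω → 𝒳}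
  {D : ℕ → Ω → Measure (Cube d)} {p y : ℕ → Ω → Cube d} {ψ : Forecaster 𝒳 d}

/-- Except with probability `δ / 2`, all sampling errors are small. -/
lemma Setup.IsInteraction.measure_exists_samplingError_gt_le [IsProbabilityMeasure μ]
    (hI : P.IsInteraction μ 𝓕 x D p y) (hψ : ∀ t, IsMarkovKernel (ψ t))
    (hfol : FollowsForecaster μ 𝓕 P.T x p y ψ) (hδ : 0 < P.δ) (hδ1 : P.δ < 1) (hT : 0 < P.T)
    (hA : 2 ≤ Fintype.card 𝒜) :
    μ {ω | ∃ k, √(6 * ((P.subseq (fun s => x s ω) k.1.2.2).card * Real.log P.complexity)) <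
      ∑ t ∈ Finset.range P.T, P.samplingError ψ (fun s => x s ω) (fun s => p s ω)
        (fun s => y s ω) k t} ≤ ENNReal.ofReal (P.δ / 2) := by
  classical
  set B : Expert (𝒩 × 𝒜 × Fin I) d → Set Ω := fun k =>
    {ω | √(6 * ((P.subseq (fun s => x s ω) k.1.2.2).card * Real.log P.complexity)) <
      ∑ t ∈ Finset.range P.T, P.samplingError ψ (fun s => x s ω) (fun s => p s ω)
        (fun s => y s ω) k t} with hB
  rw [Set.ofPred_exists]
  refine (measure_iUnion_fintype_le μ B).trans ?_
  rcases isEmpty_or_nonempty (Expert (𝒩 × 𝒜 × Fin I) d) with hE | ⟨⟨k₀⟩⟩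
  · simp
  have hK := P.two_le_complexity hδ hδ1 hT hA k₀
  have hlog : 0 < Real.log P.complexity := Real.log_pos (by linarith)
  -- The `6` under the root gives the exponent `6 / 2 = 3`. There are at most `2 δ` times complexity
  -- many experts, so the union bound leaves `2 δ / complexity² ≤ δ / 2`.
  have hone : ∀ k, μ (B k) ≤ ENNReal.ofReal ((P.complexity ^ 3)⁻¹) := by
    intro k
    rcases Nat.eq_zero_or_pos (P.len k.1.2.2) with h0 | hpos
    · refine le_trans (le_of_eq ?_) zero_le
      rw [measure_eq_zero_iff_ae_notMem]
      filter_upwards [hI.length] with ω hω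
      refine not_lt.2 (le_trans (le_of_eq ?_) (Real.sqrt_nonneg _))
      refine Finset.sum_eq_zero fun t ht => ?_
      have hS := hω k.1.2.2
      rw [h0, Finset.card_eq_zero] at hS
      have hx : x t ω ∉ P.sub k.1.2.2 t := fun hx => by
        refine Finset.notMem_empty t (hS ▸ ?_)
        exact Finset.mem_filter.2 ⟨ht, hx⟩
      have hev : ∀ h q, P.events k.1 t h (x t ω) q = 0 := fun h q => if_neg fun h => hx h.1
      simp only [Setup.samplingError, pathGain, gain, hev, zero_mul, integral_zero, mul_zero,
        sub_zero]
    · have h1 := hI.measure_samplingError_gt_le hψ hfol k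
        (Real.sqrt_nonneg (6 * (P.len k.1.2.2 * Real.log P.complexity))) hpos
      have hpos' : (0 : ℝ) < P.len k.1.2.2 := by exact_mod_cast hpos
      rw [Real.sq_sqrt (by positivity)] at h1
      have h2 : 6 * (P.len k.1.2.2 * Real.log P.complexity) / (2 * P.len k.1.2.2) =
          Real.log (P.complexity ^ 3) := by
        rw [Real.log_pow]; field_simp; norm_num
      rw [h2, Real.exp_neg, Real.exp_log (by positivity)] at h1
      refine (measure_mono_ae ?_).trans h1
      filter_upwards [hI.length] with ω hω h
      rw [← hω k.1.2.2]
      exact h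
  calc ∑ k, μ (B k) ≤ ∑ _k : Expert (𝒩 × 𝒜 × Fin I) d,
        ENNReal.ofReal ((P.complexity ^ 3)⁻¹) := Finset.sum_le_sum fun k _ => hone k
    _ = ENNReal.ofReal (Fintype.card (Expert (𝒩 × 𝒜 × Fin I) d) * (P.complexity ^ 3)⁻¹) := by
        rw [Finset.sum_const, Finset.card_univ, nsmul_eq_mul, ENNReal.ofReal_mul (by positivity),
          ENNReal.ofReal_natCast]
    _ ≤ _ := by
        refine ENNReal.ofReal_le_ofReal ?_
        have h1 := (P.card_expert_le hδ hδ1).1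
        have hT' : (1 : ℝ) ≤ P.T := by exact_mod_cast hT
        have h2 : (Fintype.card (Expert (𝒩 × 𝒜 × Fin I) d) : ℝ) ≤ 2 * (P.δ * P.complexity) :=
          (le_mul_of_one_le_right (by positivity) hT').trans h1
        rw [mul_inv_le_iff₀ (by positivity)]
        refine h2.trans ?_
        have h3 : 4 ≤ P.complexity ^ 2 := by nlinarith
        have h4 : 0 < P.δ * P.complexity := by positivity
        calc 2 * (P.δ * P.complexity) = P.δ * P.complexity / 2 * 4 := by ring
          _ ≤ P.δ * P.complexity / 2 * P.complexity ^ 2 := by gcongr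
          _ = _ := by ring

/-- With probability at least `1 - δ`, the predictions of Decision-Calibration-Subsequence yield
low swap regret. -/
lemma Setup.IsInteraction.swapRegret_le [IsProbabilityMeasure μ]
    (hI : P.IsInteraction μ 𝓕 x D p y) (hψ : P.IsDecisionCalibrationSubsequence ψ)
    (hfol : FollowsForecaster μ 𝓕 P.T x p y ψ) (hL : 0 ≤ L) (hδ : 0 < P.δ) (hδ1 : P.δ < 1) :
    ENNReal.ofReal (1 - P.δ) ≤ μ {ω | ∀ (n : 𝒩) (i : Fin I),
      (expBenchmark (P.agent n) (fun t => D t ω) (P.subseq (fun t => x t ω) i)).Nonempty →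
      swapRegret (P.agent n).u
          (expBenchmark (P.agent n) (fun t => D t ω) (P.subseq (fun t => x t ω) i))
          (P.subseq (fun t => x t ω) i)
          (P.pathAction (fun t => x t ω) (fun t => p t ω) (fun t => y t ω) n)
          (fun t => y t ω)
        ≤ 20 * L * (Fintype.card 𝒜 : ℝ) *
            √((P.subseq (fun t => x t ω) i).card * Real.log P.complexity)} := by
  classical
  rcases Nat.eq_zero_or_pos P.T with hT | hT
  · refine le_measure_of_compl_subset (Bad := ∅) hδ.le (by simp) fun ω hω => hω fun n i hne => ?_
    have h0 : (P.subseq (fun t => x t ω) i).card = 0 := by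
      simp [Setup.subseq, hT]
    refine ((P.agent n).swapRegret_le_card hL hne).trans ?_
    rw [h0]
    simp
  -- With at most one action there is no swap regret. Two actions are needed for `δ / |𝒜| ≤ δ / 2`,
  -- so that both failure events together have probability at most `δ`.
  rcases Nat.lt_or_ge (Fintype.card 𝒜) 2 with hA | hA
  · refine le_measure_of_compl_subset (Bad := ∅) hδ.le (by simp) fun ω hω => hω fun n i hne => ?_
    refine (swapRegret_le_zero_of_subsingleton _
      (Fintype.card_le_one_iff_subsingleton.1 (by omega)) hne).trans ?_
    positivity
  have hbad := (measure_union_le _ _).trans (add_le_add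
    (hI.measure_exists_threshold_lt_le hδ hδ1)
    (hI.measure_exists_samplingError_gt_le hψ.1 hfol hδ hδ1 hT hA))
  rw [← ENNReal.ofReal_add (by positivity) (by positivity)] at hbad
  have hA' : (2 : ℝ) ≤ Fintype.card 𝒜 := by exact_mod_cast hA
  have hsum : P.δ / Fintype.card 𝒜 + P.δ / 2 ≤ P.δ := by
    have : P.δ / Fintype.card 𝒜 ≤ P.δ / 2 := by gcongr
    linarith
  refine le_measure_of_compl_subset hδ.le (hbad.trans (ENNReal.ofReal_le_ofReal hsum))
    fun ω hω => ?_
  by_contra hgood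
  rw [Set.mem_union, not_or] at hgood
  refine hω fun n i hne => P.swapRegret_le_sqrt hL hδ hδ1 hT hA hψ n i hne
    (fun b hb t ht => ?_) fun k => ?_
  · have ht' : t < P.T := Finset.mem_range.1 (Finset.mem_filter.1 ht).1
    refine P.mem_cand_of_expBenchmark _ _ _ hb (fun j S => ?_) ht'.le
    by_contra hlt
    exact hgood.1 ⟨n, b, j, S, i, not_le.1 hlt⟩
  · by_contra hlt
    exact hgood.2 ⟨k, not_le.1 hlt⟩

end Main

end ConstrainedForecast

end

theorem mainTheorem12 :
    -- decision calibration implies low swap regret, for arbitrary predictions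
    (∀ (𝒳 : Type*) [MeasurableSpace 𝒳] (𝒜 : Type*) [Fintype 𝒜] (𝒩 : Type*) [Fintype 𝒩]
        (d J I : ℕ) (L : ℝ) (P : Setup 𝒳 𝒜 𝒩 d J I L),
        0 ≤ L → 0 < P.δ → P.δ < 1 →
      ∀ (Ω : Type*) [mΩ : MeasurableSpace Ω] (μ : Measure Ω) [IsProbabilityMeasure μ]
        (𝓕 : Filtration ℕ mΩ) (x : ℕ → Ω → 𝒳) (D : ℕ → Ω → Measure (Cube d))
        (p y : ℕ → Ω → Cube d), P.IsInteraction μ 𝓕 x D p y →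
      ∀ β : ℝ → ℝ, ConcaveOn ℝ (Set.Ici 0) β →
        ENNReal.ofReal (1 - P.δ) ≤ μ {ω |
          P.IsDecisionCalibrated β (fun t => x t ω) (fun t => p t ω) (fun t => y t ω) →
          ∀ (n : 𝒩) (i : Fin I),
            (expBenchmark (P.agent n) (fun t => D t ω) (P.subseq (fun t => x t ω) i)).Nonempty →
            swapRegret (P.agent n).u
                (expBenchmark (P.agent n) (fun t => D t ω) (P.subseq (fun t => x t ω) i))
                (P.subseq (fun t => x t ω) i)
                (P.pathAction (fun t => x t ω) (fun t => p t ω) (fun t => y t ω) n)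
                (fun t => y t ω)
              ≤ 2 * L * (Fintype.card 𝒜 : ℝ) *
                  β (((P.subseq (fun t => x t ω) i).card : ℝ) / (Fintype.card 𝒜 : ℝ))}) ∧
    -- Decision-Calibration-Subsequence exists and yields low swap and external regret
    ∃ C : ℝ, 0 < C ∧
      ∀ (𝒳 : Type*) [MeasurableSpace 𝒳] (𝒜 : Type*) [Fintype 𝒜] (𝒩 : Type*) [Fintype 𝒩]
        (d J I : ℕ) (L : ℝ) (P : Setup 𝒳 𝒜 𝒩 d J I L),
        0 ≤ L → 0 < P.δ → P.δ < 1 →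
      (∃ ψ : Forecaster 𝒳 d, P.IsDecisionCalibrationSubsequence ψ) ∧
      ∀ ψ : Forecaster 𝒳 d, P.IsDecisionCalibrationSubsequence ψ →
      ∀ (Ω : Type*) [mΩ : MeasurableSpace Ω] (μ : Measure Ω) [IsProbabilityMeasure μ]
        (𝓕 : Filtration ℕ mΩ) (x : ℕ → Ω → 𝒳) (D : ℕ → Ω → Measure (Cube d))
        (p y : ℕ → Ω → Cube d), P.IsInteraction μ 𝓕 x D p y →
        FollowsForecaster μ 𝓕 P.T x p y ψ →
        ENNReal.ofReal (1 - P.δ) ≤ μ {ω |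
          ∀ (n : 𝒩) (i : Fin I),
            (expBenchmark (P.agent n) (fun t => D t ω) (P.subseq (fun t => x t ω) i)).Nonempty →
            swapRegret (P.agent n).u
                (expBenchmark (P.agent n) (fun t => D t ω) (P.subseq (fun t => x t ω) i))
                (P.subseq (fun t => x t ω) i)
                (P.pathAction (fun t => x t ω) (fun t => p t ω) (fun t => y t ω) n)
                (fun t => y t ω)
              ≤ C * L * (Fintype.card 𝒜 : ℝ) *
                  √(((P.subseq (fun t => x t ω) i).card : ℝ) * Real.log
                    ((d : ℝ) * Fintype.card 𝒜 * Fintype.card 𝒩 * I * P.T / P.δ)) ∧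
            extRegret (P.agent n).u
                (expBenchmark (P.agent n) (fun t => D t ω) (P.subseq (fun t => x t ω) i))
                (P.subseq (fun t => x t ω) i)
                (P.pathAction (fun t => x t ω) (fun t => p t ω) (fun t => y t ω) n)
                (fun t => y t ω)
              ≤ C * L * (Fintype.card 𝒜 : ℝ) *
                  √(((P.subseq (fun t => x t ω) i).card : ℝ) * Real.log
                    ((d : ℝ) * Fintype.card 𝒜 * Fintype.card 𝒩 * I * P.T / P.δ))} := by
  refine ⟨?_, 20, by norm_num, ?_⟩
  · intro 𝒳 _ 𝒜 _ 𝒩 _ d J I L P hL hδ hδ1 Ω _ μ _ 𝓕 x D p y hI β hβ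
    exact hI.swapRegret_le_of_isDecisionCalibrated hL hδ hδ1 hβ
  · intro 𝒳 _ 𝒜 _ 𝒩 _ d J I L P hL hδ hδ1
    refine ⟨P.exists_isDecisionCalibrationSubsequence, ?_⟩
    intro ψ hψ Ω _ μ _ 𝓕 x D p y hI hfol
    refine (hI.swapRegret_le hψ hfol hL hδ hδ1).trans (measure_mono fun ω hω n i hne => ?_)
    exact ⟨hω n i hne, (extRegret_le_swapRegret _ hne).trans (hω n i hne)⟩
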